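/- In the Maker-Breaker domination game on a finite simple graph $G$, two players, Dominator and Staller, alternately choose a vertex of $G$ that has not been chosen before, until all vertices are chosen. Dominator wins if the vertices he has chosen form a dominating set of $G$; otherwise Staller has chosen some vertex together with all its neighbours, and she wins. The outcome $o(G)$ is $\mathcal D$ if Dominator has a winning strategy both as first and as second player, $\mathcal S$ if Staller has a winning strategy both as first and as second player, $\mathcal N$ if the first player, whoever it is, has a winning strategy, and $\mathcal P$ otherwise. For graphs $G$, $H$ with vertices $u$ of $G$ and $v$ of $H$, the glued graph of $G$ and $H$ at $u$ and $v$ is obtained from their disjoint union by identifying $u$ and $v$. The pair $(H,v)$ is neutral for the glue operator if for every finite graph $G$ and every vertex $u$ of $G$ the glued graph of $G$ and $H$ at $u$ and $v$ has outcome $o(G)$. A pendant $P_2$ of a graph is a pair of adjacent vertices $x,y$ such that $y$ is the only neighbour of $x$ and $y$ has exactly one neighbour besides $x$. A graph is $P_2$-irreducible if it has no pendant $P_2$. Theorem. (1) The path $P_3$, rooted at one of its end vertices, is neutral for the glue operator. (2) Let $T$ be a finite tree, and iteratively remove the two vertices of a pendant $P_2$, as long as there is one. However the pendant $P_2$'s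 are chosen, every graph obtained in the course of this is a tree with the same outcome as $T$, and after finitely many steps one arrives at a $P_2$-irreducible tree $T'$. If $T'$ is isomorphic to $P_2$, then $o(T)=\mathcal D$; if $T'$ is isomorphic to $K_1$ or to a star $K_{1,n}$ with $n\ge 3$, then $o(T)=\mathcal N$; in all other cases $o(T)=\mathcal S$. (3) Deciding the outcome of the Maker-Breaker domination game on trees is polynomial: there is a deterministic (multi-stack) Turing machine that, given the adjacency matrix of any finite tree $T$, outputs $o(T)$ in a number of steps bounded by a polynomial in the length of the input. -/

import Mathlib

universe u w

namespace MBDomination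

/-- The two players of the Maker-Breaker domination game. -/
inductive Player where
  | dominator
  | staller

/-- The opponent of a player. -/
def Player.other : Player → Player
  | .dominator => .staller
  | .staller => .dominator

/-- The colouring of the vertices in a position of the game: `some p` means that the vertex has
been played by `p`, and `none` means that it is unplayed. -/
abbrev Position (V : Type u) : Type u := V → Option Player

/-- The starting position, in which every vertex is unplayed. -/
def Position.start (V : Type u) : Position V := fun _ => none

/-- The position obtained from `c` when `p` plays the vertex `v`. -/
noncomputable def Position.play {V : Type u} (c : Position V) (v : V) (p : Player) : Position V :=
  open Classical in Function.update c v (some p)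

/-- The winning condition. Dominator's vertices form a dominating set, respectively Staller has
played a whole closed neighbourhood. -/
def Won {V : Type u} (G : SimpleGraph V) (c : Position V) : Player → Prop
  | .dominator => ∀ v, ∃ x, (x = v ∨ G.Adj v x) ∧ c x = some .dominator
  | .staller => ∃ v, ∀ x, (x = v ∨ G.Adj v x) → c x = some .staller

/-- `HasWinningStrategy G p q c`: in the game on `G`, from the position `c` with `q` to move,
player `p` has a winning strategy. The winner is determined once every vertex is played. As long
as an unplayed vertex is left, if it is `p`'s turn then some move has to lead to a position from
which `p` still has a winning strategy, and if it is the turn of the opponent, then every move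
has to. -/
inductive HasWinningStrategy {V : Type u} (G : SimpleGraph V) (p : Player) :
    Player → Position V → Prop
  | finished (q : Player) (c : Position V) (full : ∀ v, c v ≠ none) (won : Won G c p) :
      HasWinningStrategy G p q c
  | ownMove (c : Position V) (v : V) (free : c v = none)
      (next : HasWinningStrategy G p p.other (c.play v p)) :
      HasWinningStrategy G p p c
  | otherMove (c : Position V) (free : ∃ v, c v = none)
      (next : ∀ v, c v = none → HasWinningStrategy G p p (c.play v p.other)) :
      HasWinningStrategy G p p.other c

/-- `p` has a winning strategy on the graph `G` (from the starting position) when `q` starts. -/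
def WinsWhenStarting {V : Type u} (G : SimpleGraph V) (p q : Player) : Prop :=
  HasWinningStrategy G p q (Position.start V)

/-- The four possible outcomes. -/
inductive Outcome where
  | D
  | S
  | N
  | P

/-- The outcome of the Maker-Breaker domination game on `G`: `D` if Dominator has a winning
strategy as first and as second player, `S` if Staller has one as first and as second player,
`N` if whoever starts has one, and `P` otherwise. -/
noncomputable def outcome {V : Type u} (G : SimpleGraph V) : Outcome :=
  open Classical in
  if WinsWhenStarting G .dominator .dominator ∧ WinsWhenStarting G .dominator .staller then .D
  else if WinsWhenStarting G .staller .staller ∧ WinsWhenStarting G .staller .dominator then .S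
  else if WinsWhenStarting G .dominator .dominator ∧ WinsWhenStarting G .staller .staller then .N
  else .P

/-- The glued graph of `G` and `H` at `a` and `b`: the disjoint union with `a` and `b` identified.
The identified vertex is represented by `a`, so `b` is deleted from the vertices of `H`. -/
def glue {V : Type u} {W : Type w} (G : SimpleGraph V) (H : SimpleGraph W) (a : V) (b : W) :
    SimpleGraph (V ⊕ {y : W // y ≠ b}) where
  Adj
    | .inl x, .inl x' => G.Adj x x'
    | .inr y, .inr y' => H.Adj y y'
    | .inl x, .inr y => x = a ∧ H.Adj b y
    | .inr y, .inl x => x = a ∧ H.Adj b y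
  symm := ⟨by
    rintro (x | y) (x' | y') h
    · exact G.adj_symm h
    · exact h
    · exact h
    · exact H.adj_symm h⟩
  loopless := ⟨by
    rintro (x | y) h
    · exact G.irrefl h
    · exact H.irrefl h⟩

/-- `(H, b)` is neutral for the glue operator: gluing it to a finite graph `G`, at any vertex,
does not change the outcome of `G`. -/
def IsGlueNeutral {W : Type w} (H : SimpleGraph W) (b : W) : Prop :=
  ∀ (V : Type u) [Finite V] (G : SimpleGraph V) (a : V), outcome (glue G H a b) = outcome G

/-- The vertices `x`, `y` form a pendant `P₂` of `G`: they are adjacent, and exactly one edge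
`yz` joins them to the rest of the graph. -/
def IsPendantP2 {V : Type u} (G : SimpleGraph V) (x y : V) : Prop :=
  G.Adj x y ∧ (∀ t, G.Adj x t → t = y) ∧
    ∃ z, z ≠ x ∧ G.Adj y z ∧ ∀ t, G.Adj y t → t = x ∨ t = z

/-- A graph without pendant `P₂`. -/
def IsP2Irreducible {V : Type u} (G : SimpleGraph V) : Prop :=
  ∀ x y, ¬ IsPendantP2 G x y

/-- One removal of a pendant `P₂`, for induced subgraphs of `G` given by their vertex sets. -/
def RemovesPendantP2 {V : Type u} (G : SimpleGraph V) (s t : Set V) : Prop :=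
  ∃ x y : s, IsPendantP2 (G.induce s) x y ∧ t = s \ {x.1, y.1}

/-- The induced subgraph of `G` on `t` can be obtained from `G` by iteratively removing
pendant `P₂`'s (possibly none). -/
def IsP2Reduct {V : Type u} (G : SimpleGraph V) (t : Set V) : Prop :=
  Relation.ReflTransGen (RemovesPendantP2 G) Set.univ t

/-- `K₁`. -/
abbrev K1 : SimpleGraph (Fin 1) := ⊤

/-- `P₂`, the path on two vertices. -/
abbrev P2 : SimpleGraph (Fin 2) := SimpleGraph.pathGraph 2

/-- `P₃`, the path on three vertices, of which `0` is an end. -/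
abbrev P3 : SimpleGraph (Fin 3) := SimpleGraph.pathGraph 3

/-- `K_{1,n}`. -/
abbrev star (n : ℕ) : SimpleGraph (Fin 1 ⊕ Fin n) := completeBipartiteGraph (Fin 1) (Fin n)

/-- `G` is isomorphic to `K₁` or to a star `K_{1,n}` with `n ≥ 3`. -/
def IsK1OrStar {V : Type u} (G : SimpleGraph V) : Prop :=
  Nonempty (G ≃g K1) ∨ ∃ n, 3 ≤ n ∧ Nonempty (G ≃g star n)

/-- The inputs of the decision problem: trees with vertex set `{0, …, n - 1}`. -/
structure LabelledTree where
  n : ℕ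
  graph : SimpleGraph (Fin n)
  isTree : graph.IsTree

/-- A tree is given to the machine as its adjacency matrix, written row by row; `some b` is the
entry `b`, and the symbol `none` terminates each row. -/
noncomputable def encodeTree (T : LabelledTree) : List (Option Bool) :=
  open Classical in
  (List.finRange T.n).flatMap fun i =>
    (List.finRange T.n).map (fun j => some (decide (T.graph.Adj i j))) ++ [none]

/-- An outcome is written by the machine as a single symbol. -/
def encodeOutcome (o : Outcome) : List Outcome := [o]

/-- Deciding the outcome of the Maker-Breaker domination game on trees is polynomial: some
(multi-stack) Turing machine computes the outcome of every tree, given by its adjacency matrix, in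
a number of steps that is bounded by a polynomial in the length of the input. -/
def TreeOutcomeInPolyTime : Prop :=
  Nonempty (Turing.TM2ComputableInPolyTime encodeTree encodeOutcome
    fun T : LabelledTree => outcome T.graph)

end MBDomination

/-!
A pendant `P₂` with leaf `x` and support `y` does not change the outcome. Dominator answers each
move of Staller in `{x, y}` by the other vertex. Staller plays `y`, which forces Dominator to answer
at `x` and leaves the neighbour of `y` undominated; only the opening move `y` of Dominator needs
another idea, namely that it is no better for him than a move at the neighbour `z` of `y`, so that
Staller can follow her strategy for the smaller graph and pair `x` with `z`. Both arguments are
instances of transferring a strategy along an injection (`HasWinningStrategy.transfer`,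
`HasWinningStrategy.transfer_pair`) and are combined in `IsPendantExtension.outcome_eq`, by means of
the determinacy of the game. Gluing a `P₃` at an end is the same as attaching a pendant `P₂`.

In an irreducible tree, the neighbour of a vertex at maximal distance from a root has at least two
leaves attached to it, if this distance is at least `2` (`exists_fork_of_one_lt_dist`). If no vertex is adjacent to all others, then
taking this neighbour as a new root gives a second such fork, and Staller wins since Dominator
cannot defend both with his first move. Otherwise the tree is a star, and the outcome is clear.

For the complexity statement, a machine keeps a label for each vertex and sweeps repeatedly over the
adjacency matrix. In a sweep it counts, for each vertex, the neighbours with certain labels, selects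
the first vertex that qualifies, and relabels all vertices; what happens in a sweep is determined by
the phase (`Phase`). Three sweeps compute the degrees, find a pendant `P₂` and remove it. When there
is none left, the outcome is `𝒮`, `𝒩` or `𝒟` according to whether there are at least two vertices of
degree at least `2`, exactly one, or none; in the last case an isolated vertex means `𝒩`. A sweep
takes a number of steps linear in the length of the input, and there are at most as many removals as
vertices, whence a quadratic bound (`runsIn_of_isP2Reduct`, `runsIn_outcome`).
-/

namespace MBDomination

/-! ### Positions and strategies -/

theorem Position.play_self {V : Type u} (c : Position V) (v : V) (p : Player) :
    c.play v p v = some p := by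
  simp [Position.play]

theorem Position.play_of_ne {V : Type u} (c : Position V) {v x : V} (p : Player) (h : x ≠ v) :
    c.play v p x = c x := by
  simp [Position.play, h]

theorem Position.play_of_ne_none {V : Type u} {c : Position V} {v x : V} (p : Player)
    (hv : c v = none) (hx : c x ≠ none) : c.play v p x = c x :=
  c.play_of_ne p fun h => hx (h ▸ hv)

theorem Position.play_comp {V : Type u} {W : Type w} {f : V → W} (hf : f.Injective)
    (c : Position W) (v : V) (p : Player) :
    (fun x => c.play (f v) p (f x)) = Position.play (fun x => c (f x)) v p := by
  funext x
  by_cases h : x = v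
  · subst h; simp [Position.play_self]
  · rw [Position.play_of_ne _ _ (hf.ne h), Position.play_of_ne _ _ h]

theorem Position.play_comp_of_notMem {V : Type u} {W : Type w} {f : V → W} {a : W}
    (ha : ∀ v, f v ≠ a) (c : Position W) (p : Player) :
    (fun x => c.play a p (f x)) = fun x => c (f x) := by
  funext x
  exact Position.play_of_ne _ _ (ha x)

/-- Induction along the course of the game, backwards from the final positions. -/
theorem Position.induction {V : Type u} [Finite V] {P : Position V → Prop}
    (h : ∀ c, (∀ v p, c v = none → P (c.play v p)) → P c) (c : Position V) : P c := by
  induction hn : Set.ncard {v | c v = none} using Nat.strong_induction_on generalizing c with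
  | _ n ih =>
    refine h c fun v p hv => ih _ ?_ _ rfl
    rw [← hn]
    refine Set.ncard_lt_ncard (Set.ssubset_iff_exists.2 ⟨fun x hx => ?_, v, hv, ?_⟩)
      (Set.toFinite _)
    · by_contra hx'
      exact hx' ((Position.play_of_ne_none p hv hx').symm.trans hx)
    · simp [Position.play_self]

theorem Player.other_ne (p : Player) : p.other ≠ p := by
  cases p <;> simp [Player.other]

theorem Player.other_other (p : Player) : p.other.other = p := by
  cases p <;> rfl

theorem Player.eq_or_eq_other (p q : Player) : q = p ∨ q = p.other := by
  cases p <;> cases q <;> simp [Player.other]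

theorem Won.of_le {V : Type u} {G : SimpleGraph V} {c d : Position V} {p : Player}
    (h : Won G c p) (hcd : ∀ v, c v ≠ none → d v = c v) : Won G d p := by
  cases p with
  | dominator =>
    intro v
    obtain ⟨x, hx, hc⟩ := h v
    exact ⟨x, hx, by rw [hcd x (by simp [hc]), hc]⟩
  | staller =>
    obtain ⟨v, hv⟩ := h
    exact ⟨v, fun x hx => by rw [hcd x (by simp [hv x hx]), hv x hx]⟩

theorem Won.play {V : Type u} {G : SimpleGraph V} {c : Position V} {p : Player}
    (h : Won G c p) {v : V} (hv : c v = none) (q : Player) : Won G (c.play v q) p :=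
  h.of_le fun _ hx => Position.play_of_ne_none q hv hx

theorem Won.not_other {V : Type u} {G : SimpleGraph V} {c : Position V} {p : Player}
    (h : Won G c p) : ¬ Won G c p.other := by
  have key : Won G c .dominator → ¬ Won G c .staller := by
    rintro h ⟨v, hv⟩
    obtain ⟨x, hx, hc⟩ := h v
    simp [hv x hx] at hc
  cases p with
  | dominator => exact key h
  | staller => exact fun h' => key h' h

/-- A player who has already reached the goal wins, whatever happens afterwards. -/
theorem HasWinningStrategy.of_won {V : Type u} [Finite V] {G : SimpleGraph V} {p : Player}
    {c : Position V} (h : Won G c p) (q : Player) : HasWinningStrategy G p q c := by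
  induction c using Position.induction generalizing q with
  | h c ih =>
    by_cases hc : ∃ v, c v = none
    · rcases p.eq_or_eq_other q with rfl | rfl
      · obtain ⟨v, hv⟩ := hc
        exact .ownMove c v hv (ih v _ hv (h.play hv _) _)
      · exact .otherMove c hc fun v hv => ih v _ hv (h.play hv _) _
    · exact .finished q c (not_exists.1 hc) h

theorem HasWinningStrategy.of_won_play {V : Type u} [Finite V] {G : SimpleGraph V} {p : Player}
    {c : Position V} {v : V} (hv : c v = none) (h : Won G (c.play v p) p) :
    HasWinningStrategy G p p c :=
  .ownMove c v hv (.of_won h _)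

theorem HasWinningStrategy.inv {V : Type u} {G : SimpleGraph V} {p q : Player}
    {c : Position V} (h : HasWinningStrategy G p q c) :
    (∀ v, c v ≠ none) ∧ Won G c p ∨
      (q = p ∧ ∃ v, c v = none ∧ HasWinningStrategy G p p.other (c.play v p)) ∨
      (q = p.other ∧ (∃ v, c v = none) ∧
        ∀ v, c v = none → HasWinningStrategy G p p (c.play v p.other)) := by
  cases h with
  | finished _ _ full won => exact .inl ⟨full, won⟩
  | ownMove _ v free next => exact .inr (.inl ⟨rfl, v, free, next⟩)
  | otherMove _ free next => exact .inr (.inr ⟨rfl, free, next⟩)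

/-- The two players cannot both have a winning strategy. -/
theorem HasWinningStrategy.not_other {V : Type u} {G : SimpleGraph V} {p q : Player}
    {c : Position V} (h : HasWinningStrategy G p q c) : ¬ HasWinningStrategy G p.other q c := by
  induction h with
  | finished q c full won =>
    intro h
    rcases h.inv with ⟨_, won'⟩ | ⟨_, v, free, _⟩ | ⟨_, ⟨v, free⟩, _⟩
    · exact won.not_other won'
    · exact full v free
    · exact full v free
  | ownMove c v free next ih =>
    intro h
    rcases h.inv with ⟨full, _⟩ | ⟨h, _⟩ | ⟨_, _, h⟩
    · exact full v free
    · exact p.other_ne h.symm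
    · have := h v free
      rw [p.other_other] at this
      exact ih this
  | otherMove c free next ih =>
    intro h
    rcases h.inv with ⟨full, _⟩ | ⟨_, v, hv, h⟩ | ⟨h, _⟩
    · exact free.elim full
    · rw [p.other_other] at h
      exact ih v hv h
    · exact p.other.other_ne h.symm

/-- The game is determined. -/
theorem HasWinningStrategy.dominator_or_staller {V : Type u} [Finite V] (G : SimpleGraph V)
    (q : Player) (c : Position V) :
    HasWinningStrategy G .dominator q c ∨ HasWinningStrategy G .staller q c := by
  induction c using Position.induction generalizing q with
  | h c ih =>
    by_cases hc : ∃ v, c v = none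
    · cases q with
      | dominator =>
        by_cases h : ∃ v, c v = none ∧
            HasWinningStrategy G .dominator .staller (c.play v .dominator)
        · obtain ⟨v, hv, h⟩ := h
          exact .inl (.ownMove c v hv h)
        · exact .inr (.otherMove (p := .staller) c hc fun v hv =>
            (ih v _ hv _).resolve_left fun h' => h ⟨v, hv, h'⟩)
      | staller =>
        by_cases h : ∃ v, c v = none ∧
            HasWinningStrategy G .staller .dominator (c.play v .staller)
        · obtain ⟨v, hv, h⟩ := h
          exact .inr (.ownMove c v hv h)
        · exact .inl (.otherMove (p := .dominator) c hc fun v hv =>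
            (ih v _ hv _).resolve_right fun h' => h ⟨v, hv, h'⟩)
    · have hc := not_exists.1 hc
      by_cases h : Won G c .dominator
      · exact .inl (.finished q c hc h)
      · refine .inr (.finished q c hc ?_)
        simp only [Won, not_forall, not_exists, not_and] at h
        obtain ⟨v, hv⟩ := h
        refine ⟨v, fun x hx => ?_⟩
        have h1 := hc x
        have h2 := hv x hx
        match hcx : c x with
        | none => exact absurd hcx h1
        | some .dominator => exact absurd hcx h2
        | some .staller => rfl

/-! ### Transferring strategies along an injection -/

/-- A strategy on `G` is a strategy on a larger graph `H` if every additional vertex has been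
played and if reaching the goal on `G` means reaching it on `H`. -/
theorem HasWinningStrategy.transfer {V : Type u} {W : Type w} {G : SimpleGraph V}
    {H : SimpleGraph W} {f : V → W} (hf : f.Injective) {p q : Player} {c₀ : Position V}
    (h : HasWinningStrategy G p q c₀) (c : Position W) (hc : (fun v => c (f v)) = c₀)
    (full : ∀ w, c w = none → ∃ v, f v = w)
    (won : ∀ d : Position W, (∀ w, c w ≠ none → d w = c w) →
      Won G (fun v => d (f v)) p → Won H d p) :
    HasWinningStrategy H p q c := by
  induction h generalizing c with
  | finished q c₀ full₀ won₀ =>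
    subst hc
    refine .finished q c (fun w hw => ?_) (won c (fun _ _ => rfl) won₀)
    obtain ⟨v, rfl⟩ := full w hw
    exact full₀ v hw
  | ownMove c₀ v free next ih =>
    subst hc
    refine .ownMove c (f v) free (ih _ (Position.play_comp hf c v p) (fun w hw => ?_)
      fun d hd => won d fun w hw => ?_)
    · exact full w (by_contra fun h => h ((Position.play_of_ne_none p free h).symm.trans hw))
    · have := Position.play_of_ne_none p free hw
      rw [← this]
      exact hd w (this ▸ hw)
  | otherMove c₀ free next ih =>
    subst hc
    refine .otherMove c (free.imp' f fun v hv => hv) fun w hw => ?_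
    obtain ⟨v, rfl⟩ := full w hw
    refine ih v hw _ (Position.play_comp hf c v _) (fun w' hw' => ?_)
      fun d hd => won d fun w' hw' => ?_
    · exact full w' (by_contra fun h => h ((Position.play_of_ne_none _ hw h).symm.trans hw'))
    · have := Position.play_of_ne_none p.other hw hw'
      rw [← this]
      exact hd w' (this ▸ hw')

/-- The pairing strategy: a strategy on `G` is also one on a larger graph `H` with two additional
vertices `a`, `b`, both unplayed, because a move of the opponent at one of them is answered at the
other one. -/
theorem HasWinningStrategy.transfer_pair {V : Type u} {W : Type w} [Finite W] {G : SimpleGraph V}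
    {H : SimpleGraph W} {f : V → W} (hf : f.Injective) {a b : W} (hab : a ≠ b)
    (ha : ∀ v, f v ≠ a) (hb : ∀ v, f v ≠ b) (cover : ∀ w, w = a ∨ w = b ∨ ∃ v, f v = w)
    {p q : Player} {c₀ : Position V}
    (h : HasWinningStrategy G p q c₀) (c : Position W) (hc : (fun v => c (f v)) = c₀)
    (hca : c a = none) (hcb : c b = none)
    (won : ∀ d : Position W, (∀ w, c w ≠ none → d w = c w) → (d a = some p ∨ d b = some p) →
      Won G (fun v => d (f v)) p → Won H d p) :
    HasWinningStrategy H p q c := by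
  -- once the opponent plays at the vertex `x` of the pair, the answer `y` makes `transfer` apply
  have answer : ∀ (c : Position W), c a = none → c b = none →
      (∀ d : Position W, (∀ w, c w ≠ none → d w = c w) → (d a = some p ∨ d b = some p) →
        Won G (fun v => d (f v)) p → Won H d p) →
      HasWinningStrategy G p p.other (fun v => c (f v)) →
      ∀ x y, (x = a ∧ y = b ∨ x = b ∧ y = a) →
        HasWinningStrategy H p p (c.play x p.other) := by
    intro c hca hcb won h x y hxy
    have hne : y ≠ x := by rcases hxy with ⟨rfl, rfl⟩ | ⟨rfl, rfl⟩ <;> [exact hab.symm; exact hab]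
    have hx : ∀ v, f v ≠ x := by rcases hxy with ⟨rfl, rfl⟩ | ⟨rfl, rfl⟩ <;> assumption
    have hy : ∀ v, f v ≠ y := by rcases hxy with ⟨rfl, rfl⟩ | ⟨rfl, rfl⟩ <;> assumption
    have hcx : c x = none := by rcases hxy with ⟨rfl, rfl⟩ | ⟨rfl, rfl⟩ <;> assumption
    have hcy : c y = none := by rcases hxy with ⟨rfl, rfl⟩ | ⟨rfl, rfl⟩ <;> assumption
    have hcy' : c.play x p.other y = none := by rw [Position.play_of_ne _ _ hne, hcy]
    refine .ownMove _ y hcy' (h.transfer hf _ ?_ (fun w hw => ?_) fun d hd => won d ?_ ?_)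
    · rw [Position.play_comp_of_notMem hy, Position.play_comp_of_notMem hx]
    · have h1 : w ≠ y := by rintro rfl; simp [Position.play_self] at hw
      rw [Position.play_of_ne _ _ h1] at hw
      have h2 : w ≠ x := by rintro rfl; simp [Position.play_self] at hw
      rcases cover w with h | h | h
      · rcases hxy with ⟨rfl, rfl⟩ | ⟨rfl, rfl⟩ <;> [exact absurd h h2; exact absurd h h1]
      · rcases hxy with ⟨rfl, rfl⟩ | ⟨rfl, rfl⟩ <;> [exact absurd h h1; exact absurd h h2]
      · exact h
    · intro w hw
      have e1 := Position.play_of_ne_none p.other hcx hw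
      have e2 := Position.play_of_ne_none p hcy' (e1 ▸ hw)
      rw [hd w (by rw [e2, e1]; exact hw), e2, e1]
    · have : d y = some p := by
        rw [hd y (by simp [Position.play_self]), Position.play_self]
      rcases hxy with ⟨rfl, rfl⟩ | ⟨rfl, rfl⟩ <;> [exact .inr this; exact .inl this]
  induction h generalizing c with
  | finished q c₀ full₀ won₀ =>
    subst hc
    rcases p.eq_or_eq_other q with rfl | rfl
    · refine .ownMove c a hca (.of_won (won _ (fun w hw => Position.play_of_ne_none _ hca hw)
        (.inl (Position.play_self ..)) ?_) _)
      rwa [Position.play_comp_of_notMem ha]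
    · refine .otherMove c ⟨a, hca⟩ fun w hw => ?_
      have h0 := HasWinningStrategy.finished p.other _ full₀ won₀
      rcases cover w with rfl | rfl | ⟨v, rfl⟩
      · exact answer c hca hcb won h0 w b (.inl ⟨rfl, rfl⟩)
      · exact answer c hca hcb won h0 w a (.inr ⟨rfl, rfl⟩)
      · exact absurd hw (full₀ v)
  | ownMove c₀ v free next ih =>
    subst hc
    refine .ownMove c (f v) free (ih _ (Position.play_comp hf c v p) ?_ ?_
      fun d hd => won d fun w hw => ?_)
    · rw [Position.play_of_ne _ _ (ha v).symm, hca]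
    · rw [Position.play_of_ne _ _ (hb v).symm, hcb]
    · have := Position.play_of_ne_none p free hw
      rw [← this]
      exact hd w (this ▸ hw)
  | otherMove c₀ free next ih =>
    subst hc
    have h0 := HasWinningStrategy.otherMove _ free next
    refine .otherMove c ⟨a, hca⟩ fun w hw => ?_
    rcases cover w with rfl | rfl | ⟨v, rfl⟩
    · exact answer c hca hcb won h0 w b (.inl ⟨rfl, rfl⟩)
    · exact answer c hca hcb won h0 w a (.inr ⟨rfl, rfl⟩)
    · refine ih v hw _ (Position.play_comp hf c v _) ?_ ?_ fun d hd => won d fun w' hw' => ?_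
      · rw [Position.play_of_ne _ _ (ha v).symm, hca]
      · rw [Position.play_of_ne _ _ (hb v).symm, hcb]
      · have := Position.play_of_ne_none p.other hw hw'
        rw [← this]
        exact hd w' (this ▸ hw')

/-! ### Pendant `P₂`'s and the outcome -/

/-- Since the game is determined, it suffices to transfer winning strategies in one direction. -/
theorem outcome_eq_of_wins_imp {V : Type u} {W : Type w} [Finite V] {G : SimpleGraph V}
    {H : SimpleGraph W} (h : ∀ p q, WinsWhenStarting G p q → WinsWhenStarting H p q) :
    outcome H = outcome G := by
  have key : ∀ p q, WinsWhenStarting H p q ↔ WinsWhenStarting G p q := by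
    refine fun p q => ⟨fun hH => ?_, h p q⟩
    by_contra hG
    have hG' : WinsWhenStarting G p.other q := by
      have := HasWinningStrategy.dominator_or_staller G q (Position.start V)
      cases p with
      | dominator => exact this.resolve_left hG
      | staller => exact this.resolve_right hG
    exact hH.not_other (h _ _ hG')
  have key' : WinsWhenStarting H = WinsWhenStarting G :=
    funext fun p => funext fun q => propext (key p q)
  unfold outcome
  rw [key']

theorem outcome_eq_of_iso {V : Type u} {W : Type w} [Finite V] {G : SimpleGraph V}
    {H : SimpleGraph W} (e : G ≃g H) : outcome H = outcome G := by
  refine outcome_eq_of_wins_imp fun p q h => h.transfer e.injective _ rfl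
    (fun w _ => e.surjective w) fun d _ hd => ?_
  cases p with
  | dominator =>
    intro w
    obtain ⟨v, rfl⟩ := e.surjective w
    obtain ⟨u, hu, hdu⟩ := hd v
    exact ⟨e u, hu.imp (congrArg e) e.map_adj_iff.2, hdu⟩
  | staller =>
    obtain ⟨v, hv⟩ := hd
    refine ⟨e v, fun w hw => ?_⟩
    obtain ⟨u, rfl⟩ := e.surjective w
    exact hv u (hw.imp (fun h => e.injective h) e.map_adj_iff.1)

/-- The graph `H` consists of the image of `G` under the embedding `f`, a vertex `x` whose only
neighbour is `y`, and the vertex `y`, which has no neighbours besides `x` and `f z`. -/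
structure IsPendantExtension {V : Type u} {W : Type w} {G : SimpleGraph V} {H : SimpleGraph W}
    (f : G ↪g H) (x y : W) (z : V) : Prop where
  ne_fst : ∀ v, f v ≠ x
  ne_snd : ∀ v, f v ≠ y
  cover : ∀ w, w = x ∨ w = y ∨ ∃ v, f v = w
  adj : H.Adj x y
  eq_snd : ∀ w, H.Adj x w → w = y
  eq_or_eq : ∀ w, H.Adj y w → w = x ∨ w = f z

/-- A pendant `P₂` does not influence the outcome. Dominator pairs its two vertices. Staller
plays `y`, which forces Dominator to play the leaf `x` and leaves `f z` undominated; if Dominator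
opens with `y`, then Staller goes on as if he had opened with `f z`, and pairs `x` with `f z`. -/
theorem IsPendantExtension.outcome_eq {V : Type u} {W : Type w} [Finite V] [Finite W]
    {G : SimpleGraph V} {H : SimpleGraph W} {f : G ↪g H} {x y : W} {z : V}
    (h : IsPendantExtension f x y z) : outcome H = outcome G := by
  obtain ⟨hfx, hfy, cover, hxy, hx, hy⟩ := h
  refine outcome_eq_of_wins_imp fun p q h => ?_
  cases p with
  | dominator =>
    refine h.transfer_pair f.injective hxy.ne hfx hfy cover _ rfl rfl rfl fun d _ hd hw w => ?_
    rcases cover w with rfl | rfl | ⟨v, rfl⟩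
    · exact hd.elim (fun h => ⟨_, .inl rfl, h⟩) fun h => ⟨_, .inr hxy, h⟩
    · exact hd.elim (fun h => ⟨_, .inr hxy.symm, h⟩) fun h => ⟨_, .inl rfl, h⟩
    · obtain ⟨u, hu, hdu⟩ := hw v
      exact ⟨f u, hu.imp (congrArg f) f.map_adj_iff.2, hdu⟩
  | staller =>
    have forced : ∀ {q : Player} (c : Position W),
        HasWinningStrategy G .staller q (fun v => c (f v)) → c x ≠ none → c y = some .staller →
        HasWinningStrategy H .staller q c := by
      refine fun c h hcx hcy => h.transfer f.injective c rfl (fun w hw => ?_) fun d hd hw => ?_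
      · rcases cover w with rfl | rfl | h
        · exact absurd hw hcx
        · simp [hcy] at hw
        · exact h
      · obtain ⟨v, hv⟩ := hw
        refine ⟨f v, fun w hw => ?_⟩
        rcases cover w with rfl | rfl | ⟨u, rfl⟩
        · rcases hw with hw | hw
          · exact absurd hw.symm (hfx v)
          · exact absurd (hx _ hw.symm) (hfy v)
        · rw [hd _ (by simp [hcy]), hcy]
        · exact hv u (hw.imp (fun h => f.injective h) f.map_adj_iff.1)
    have threat : ∀ c : Position W, HasWinningStrategy G .staller .staller (fun v => c (f v)) →
        c x = none → c y = none → HasWinningStrategy H .staller .staller c := by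
      intro c h hcx hcy
      have hcx' : c.play y .staller x = none := by rw [Position.play_of_ne _ _ hxy.ne, hcx]
      refine .ownMove c y hcy (.otherMove (p := .staller) _ ⟨x, hcx'⟩ fun w hw => ?_)
      have hwy : w ≠ y := by rintro rfl; simp [Position.play_self] at hw
      by_cases hwx : w = x
      · subst hwx
        refine forced _ ?_ (by simp [Position.play_self]) ?_
        · rwa [Position.play_comp_of_notMem hfx, Position.play_comp_of_notMem hfy]
        · rw [Position.play_of_ne _ _ hwy.symm, Position.play_self]
      · refine .of_won_play (v := x) (by rw [Position.play_of_ne _ _ (Ne.symm hwx), hcx']) ?_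
        refine ⟨x, fun t ht => ?_⟩
        by_cases htx : t = x
        · subst htx; exact Position.play_self ..
        · obtain rfl := hx t (ht.resolve_left htx)
          rw [Position.play_of_ne _ _ htx, Position.play_of_ne _ _ hwy.symm, Position.play_self]
    cases q with
    | staller => exact threat _ h rfl rfl
    | dominator =>
      rcases h.inv with ⟨full, _⟩ | ⟨h, _⟩ | ⟨_, _, next⟩
      · exact absurd rfl (full z)
      · simp at h
      refine .otherMove (p := .staller) _ ⟨x, rfl⟩ fun w _ => ?_
      rcases cover w with rfl | rfl | ⟨v, rfl⟩
      · refine .ownMove _ y ?_ (forced _ ?_ ?_ (Position.play_self ..))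
        · rw [Position.play_of_ne _ _ hxy.ne.symm]; rfl
        · rwa [Position.play_comp_of_notMem hfy, Position.play_comp_of_notMem hfx]
        · rw [Position.play_of_ne _ _ hxy.ne]; simp [Position.play_self]
      · -- along `f'` the vertex `w` takes the place of `f z`
        let f' : V → W := fun v => open Classical in if v = z then w else f v
        have f'z : f' z = w := if_pos rfl
        have f'v : ∀ v, v ≠ z → f' v = f v := fun v hv => if_neg hv
        have hf' : f'.Injective := by
          intro a b hab
          by_cases ha : a = z <;> by_cases hb : b = z
          · rw [ha, hb]
          · rw [ha, f'z, f'v b hb] at hab; exact absurd hab.symm (hfy b)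
          · rw [hb, f'z, f'v a ha] at hab; exact absurd hab (hfy a)
          · rw [f'v a ha, f'v b hb] at hab; exact f.injective hab
        refine (next z rfl).transfer_pair hf' (a := x) (b := f z) (hfx z).symm
          ?_ ?_ ?_ _ ?_ ?_ ?_ ?_
        · intro v
          by_cases hv : v = z
          · rw [hv, f'z]; exact hxy.ne.symm
          · rw [f'v v hv]; exact hfx v
        · intro v
          by_cases hv : v = z
          · rw [hv, f'z]; exact (hfy z).symm
          · rw [f'v v hv]; exact f.injective.ne hv
        · intro t
          rcases cover t with rfl | rfl | ⟨v, rfl⟩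
          · exact .inl rfl
          · exact .inr (.inr ⟨z, f'z⟩)
          · by_cases hv : v = z
            · exact .inr (.inl (by rw [hv]))
            · exact .inr (.inr ⟨v, f'v v hv⟩)
        · funext v
          by_cases hv : v = z
          · subst hv; rw [f'z, Position.play_self, Position.play_self]
          · rw [f'v v hv, Position.play_of_ne _ _ (hfy v), Position.play_of_ne _ _ hv]; rfl
        · rw [Position.play_of_ne _ _ hxy.ne]; rfl
        · rw [Position.play_of_ne _ _ (hfy z)]; rfl
        · rintro d hd - ⟨v, hv⟩
          have hdw : d w = some .dominator := by
            rw [hd w (by simp [Position.play_self]), Position.play_self]; rfl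
          have hz : ∀ u, (u = v ∨ G.Adj v u) → u ≠ z := by
            rintro u hu rfl
            have := hv u hu
            simp [f'z, hdw] at this
          refine ⟨f v, fun t ht => ?_⟩
          rcases cover t with rfl | rfl | ⟨u, rfl⟩
          · rcases ht with ht | ht
            · exact absurd ht.symm (hfx v)
            · exact absurd (hx _ ht.symm) (hfy v)
          · rcases ht with ht | ht
            · exact absurd ht.symm (hfy v)
            · rcases hy _ ht.symm with h | h
              · exact absurd h (hfx v)
              · exact absurd (f.injective h) (hz v (.inl rfl))
          · have hu := ht.imp (fun h => f.injective h) f.map_adj_iff.1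
            rw [← f'v u (hz u hu)]
            exact hv u hu
      · refine threat _ ?_ ?_ ?_
        · rw [Position.play_comp f.injective]; exact next v rfl
        · rw [Position.play_of_ne _ _ (hfx v).symm]; rfl
        · rw [Position.play_of_ne _ _ (hfy v).symm]; rfl

theorem isGlueNeutral_P3 : IsGlueNeutral.{u} P3 0 := by
  intro V _ G a
  have adj : ∀ i j : Fin 3, P3.Adj i j ↔ i.1 + 1 = j.1 ∨ j.1 + 1 = i.1 := fun i j =>
    SimpleGraph.pathGraph_adj
  let f : G ↪g glue G P3 a 0 := ⟨⟨Sum.inl, Sum.inl_injective⟩, Iff.rfl⟩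
  have hf : ∀ v, f v = Sum.inl v := fun _ => rfl
  refine IsPendantExtension.outcome_eq (f := f) (x := .inr ⟨2, by decide⟩)
    (y := .inr ⟨1, by decide⟩) (z := a) ⟨by simp [hf], by simp [hf], ?_, ?_, ?_, ?_⟩
  · rintro (v | ⟨i, hi⟩)
    · exact .inr (.inr ⟨v, rfl⟩)
    · fin_cases i <;> simp at hi ⊢
  · exact (adj _ _).2 (by decide)
  · rintro (v | ⟨i, hi⟩) h
    · exact absurd ((adj _ _).1 h.2) (by decide)
    · have := (adj _ _).1 h
      fin_cases i <;> simp at hi this ⊢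
  · rintro (v | ⟨i, hi⟩) h
    · exact .inr (congrArg Sum.inl h.1)
    · have := (adj _ _).1 h
      fin_cases i <;> simp at hi this ⊢

/-! ### Outcomes of small configurations -/

theorem outcome_eq_D {V : Type u} {G : SimpleGraph V}
    (h₁ : WinsWhenStarting G .dominator .dominator)
    (h₂ : WinsWhenStarting G .dominator .staller) : outcome G = .D := by
  simp [outcome, h₁, h₂]

theorem outcome_eq_S {V : Type u} {G : SimpleGraph V}
    (h₁ : WinsWhenStarting G .staller .staller)
    (h₂ : WinsWhenStarting G .staller .dominator) : outcome G = .S := by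
  have : ¬ WinsWhenStarting G .dominator .staller := h₁.not_other
  simp [outcome, h₁, h₂, this]

theorem outcome_eq_N {V : Type u} {G : SimpleGraph V}
    (h₁ : WinsWhenStarting G .dominator .dominator)
    (h₂ : WinsWhenStarting G .staller .staller) : outcome G = .N := by
  have h₃ : ¬ WinsWhenStarting G .dominator .staller := h₂.not_other
  have h₄ : ¬ WinsWhenStarting G .staller .dominator := h₁.not_other
  simp [outcome, h₁, h₂, h₃, h₄]

/-- The vertices `l`, `l'` are two leaves attached to `y`. -/
structure IsFork {V : Type u} (G : SimpleGraph V) (y l l' : V) : Prop where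
  adj : G.Adj y l
  adj' : G.Adj y l'
  ne : l ≠ l'
  leaf : ∀ t, G.Adj l t → t = y
  leaf' : ∀ t, G.Adj l' t → t = y

/-- On an unplayed fork Staller plays the centre and then one of the two leaves. -/
theorem IsFork.hasWinningStrategy {V : Type u} [Finite V] {G : SimpleGraph V} {y l l' : V}
    (h : IsFork G y l l') {c : Position V} (hy : c y = none) (hl : c l = none)
    (hl' : c l' = none) : HasWinningStrategy G .staller .staller c := by
  refine .ownMove c y hy (.otherMove (p := .staller) _ ⟨l, ?_⟩ fun w hw => ?_)
  · rw [Position.play_of_ne _ _ h.adj.ne.symm, hl]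
  have hwy : y ≠ w := by rintro rfl; simp [Position.play_self] at hw
  have key : ∀ m, m ≠ w → G.Adj y m → c m = none → (∀ t, G.Adj m t → t = y) →
      HasWinningStrategy G .staller .staller
        ((c.play y .staller).play w Player.staller.other) := by
    intro m hmw hym hm hleaf
    refine .of_won_play (v := m) ?_ ?_
    · rw [Position.play_of_ne _ _ hmw, Position.play_of_ne _ _ hym.ne.symm, hm]
    · refine ⟨m, fun t ht => ?_⟩
      rcases ht with rfl | ht
      · exact Position.play_self ..
      · rw [hleaf t ht, Position.play_of_ne _ _ hym.ne, Position.play_of_ne _ _ hwy,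
          Position.play_self]
  by_cases hlw : l = w
  · exact key l' (fun h' => h.ne (hlw.trans h'.symm)) h.adj' hl' h.leaf'
  · exact key l hlw h.adj hl h.leaf

theorem IsFork.adj_center_ne {V : Type u} {G : SimpleGraph V} {y l l' y' m m' : V}
    (h : IsFork G y l l') (h' : IsFork G y' m m') (hne : y ≠ y') : m ≠ y ∧ m ≠ l ∧ m ≠ l' := by
  refine ⟨?_, ?_, ?_⟩
  · rintro rfl
    exact h.ne ((h'.leaf _ h.adj).trans (h'.leaf _ h.adj').symm)
  · rintro rfl
    exact hne (h'.leaf _ h.adj.symm)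
  · rintro rfl
    exact hne (h'.leaf _ h.adj'.symm)

theorem IsFork.symm {V : Type u} {G : SimpleGraph V} {y l l' : V}
    (h : IsFork G y l l') : IsFork G y l' l :=
  ⟨h.adj', h.adj, h.ne.symm, h.leaf', h.leaf⟩

/-- Dominator cannot touch two forks with one move. -/
theorem outcome_eq_S_of_forks {V : Type u} [Finite V] {G : SimpleGraph V} {y l l' y' m m' : V}
    (h : IsFork G y l l') (h' : IsFork G y' m m') (hne : y ≠ y') : outcome G = .S := by
  refine outcome_eq_S (h.hasWinningStrategy rfl rfl rfl)
    (.otherMove (p := .staller) _ ⟨y, rfl⟩ fun w _ => ?_)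
  have free : ∀ {x : V}, x ≠ w →
      (Position.start V).play w Player.staller.other x = none := fun hx => by
    rw [Position.play_of_ne _ _ hx]; rfl
  by_cases hw : w = y ∨ w = l ∨ w = l'
  · have h1 := h.adj_center_ne h' hne
    have h2 := h.adj_center_ne h'.symm hne
    have h3 := (h'.adj_center_ne h hne.symm).1
    have h4 := (h'.adj_center_ne h.symm hne.symm).1
    refine h'.hasWinningStrategy (free ?_) (free ?_) (free ?_) <;> rintro rfl <;>
      rcases hw with hw | hw | hw
    · exact hne hw.symm
    · exact h3 hw.symm
    · exact h4 hw.symm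
    · exact h1.1 hw
    · exact h1.2.1 hw
    · exact h1.2.2 hw
    · exact h2.1 hw
    · exact h2.2.1 hw
    · exact h2.2.2 hw
  · push Not at hw
    exact h.hasWinningStrategy (free hw.1.symm) (free hw.2.1.symm) (free hw.2.2.symm)

theorem winsWhenStarting_dominator_of_universal {V : Type u} [Finite V] {G : SimpleGraph V}
    {c : V} (h : ∀ v, v = c ∨ G.Adj c v) : WinsWhenStarting G .dominator .dominator :=
  .of_won_play (v := c) rfl fun v =>
    ⟨c, (h v).imp Eq.symm fun h => h.symm, Position.play_self ..⟩

theorem outcome_eq_N_of_subsingleton {V : Type u} [Finite V] {G : SimpleGraph V} {c : V}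
    (h : ∀ v, v = c) : outcome G = .N := by
  refine outcome_eq_N (winsWhenStarting_dominator_of_universal fun v => .inl (h v))
    (.of_won_play (v := c) rfl ⟨c, fun x _ => ?_⟩)
  rw [h x, Position.play_self]

theorem outcome_eq_N_of_universal {V : Type u} [Finite V] {G : SimpleGraph V} {c l l' : V}
    (h : ∀ v, v = c ∨ G.Adj c v) (hl : IsFork G c l l') : outcome G = .N :=
  outcome_eq_N (winsWhenStarting_dominator_of_universal h) (hl.hasWinningStrategy rfl rfl rfl)

theorem outcome_eq_D_of_pair {V : Type u} [Finite V] {G : SimpleGraph V} {a b : V}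
    (hab : G.Adj a b) (h : ∀ v, v = a ∨ v = b) : outcome G = .D := by
  refine outcome_eq_D (winsWhenStarting_dominator_of_universal (c := a) fun v =>
    (h v).imp_right fun h => by rw [h]; exact hab)
    (.otherMove (p := .dominator) _ ⟨a, rfl⟩ fun w _ => ?_)
  obtain ⟨w', hw⟩ : ∃ w', G.Adj w w' ∧ ∀ v, v = w ∨ v = w' := by
    rcases h w with rfl | rfl
    · exact ⟨b, hab, h⟩
    · exact ⟨a, hab.symm, fun v => (h v).symm⟩
  refine .of_won_play (v := w') (by rw [Position.play_of_ne _ _ hw.1.ne.symm]; rfl)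
    fun v => ⟨w', ?_, Position.play_self ..⟩
  rcases hw.2 v with rfl | rfl
  · exact .inr hw.1
  · exact .inl rfl

/-! ### Irreducible trees -/

theorem exists_adj_dist_eq_dist_add_one {V : Type u} {G : SimpleGraph V} (hG : G.IsTree) {r v : V}
    (h : v ≠ r) : ∃ a, G.Adj v a ∧ G.dist r v = G.dist r a + 1 := by
  obtain ⟨p, hp⟩ := hG.connected.exists_walk_length_eq_dist v r
  cases p with
  | nil => exact absurd rfl h
  | @cons _ a _ hadj q =>
    refine ⟨a, hadj, ?_⟩
    have h1 := SimpleGraph.dist_le q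
    rw [SimpleGraph.Walk.length_cons] at hp
    rcases hG.dist_eq_dist_add_one_of_adj r hadj with h2 | h2
    · exact h2
    · rw [SimpleGraph.dist_comm (u := r), SimpleGraph.dist_comm (u := r)] at h2
      omega

theorem eq_of_adj_of_dist_eq_dist_add_one {V : Type u} {G : SimpleGraph V} (hG : G.IsTree)
    {r v a b : V} (ha : G.Adj v a) (hb : G.Adj v b) (hda : G.dist r v = G.dist r a + 1)
    (hdb : G.dist r v = G.dist r b + 1) : a = b := by
  obtain ⟨p, hp⟩ := hG.connected.exists_walk_length_eq_dist r a
  obtain ⟨q, hq⟩ := hG.connected.exists_walk_length_eq_dist r b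
  have hp' : (p.concat ha.symm).IsPath := SimpleGraph.Walk.isPath_of_length_eq_dist _ (by
    rw [SimpleGraph.Walk.length_concat, hp, hda])
  have hq' : (q.concat hb.symm).IsPath := SimpleGraph.Walk.isPath_of_length_eq_dist _ (by
    rw [SimpleGraph.Walk.length_concat, hq, hdb])
  have h := congrArg Subtype.val ((hG.isAcyclic.subsingleton_path _ _).elim ⟨_, hp'⟩ ⟨_, hq'⟩)
  have h' := congrArg SimpleGraph.Walk.penultimate h
  simpa using h'

/-- In an irreducible tree, the neighbour `y` of a vertex at maximal distance from the root `r` is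
the centre of a fork: all its neighbours except its parent are leaves. -/
theorem exists_fork_of_one_lt_dist {V : Type u} [Finite V] {G : SimpleGraph V} (hG : G.IsTree)
    (hirr : IsP2Irreducible G) {r v : V} (h : 1 < G.dist r v) :
    ∃ y l l', y ≠ r ∧ IsFork G y l l' := by
  have : Nonempty V := ⟨r⟩
  obtain ⟨x, hx⟩ := Finite.exists_max (fun v => G.dist r v)
  have hxr : 1 < G.dist r x := h.trans_le (hx v)
  obtain ⟨y, hxy, hdy⟩ := exists_adj_dist_eq_dist_add_one hG (r := r) (v := x)
    (by rintro rfl; simp at hxr)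
  have hyr : y ≠ r := by rintro rfl; rw [SimpleGraph.dist_self] at hdy; omega
  obtain ⟨z, hyz, hdz⟩ := exists_adj_dist_eq_dist_add_one hG hyr
  have leaf : ∀ t, G.Adj y t → G.dist r t = G.dist r x → ∀ s, G.Adj t s → s = y := by
    intro t hyt hdt s hts
    refine eq_of_adj_of_dist_eq_dist_add_one hG (r := r) hts hyt.symm ?_ (by omega)
    have := hx s
    rcases hG.dist_eq_dist_add_one_of_adj r hts with h | h <;> omega
  have hzx : z ≠ x := by rintro rfl; omega
  obtain ⟨t, hyt, htx, htz⟩ : ∃ t, G.Adj y t ∧ t ≠ x ∧ t ≠ z := by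
    by_contra hcon
    push Not at hcon
    exact hirr x y ⟨hxy, leaf x hxy.symm rfl, z, hzx, hyz, fun t ht =>
      or_iff_not_imp_left.2 (hcon t ht)⟩
  refine ⟨y, x, t, hyr, hxy.symm, hyt, htx.symm, leaf x hxy.symm rfl, leaf t hyt ?_⟩
  rcases hG.dist_eq_dist_add_one_of_adj r hyt with h | h
  · exact absurd (eq_of_adj_of_dist_eq_dist_add_one hG hyt hyz h hdz) htz
  · omega

/-- The centre of a first fork serves as the root in the search for a second one. -/
theorem exists_forks_of_forall_not_universal {V : Type u} [Finite V] {G : SimpleGraph V}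
    (hG : G.IsTree) (hirr : IsP2Irreducible G) (h : ¬ ∃ c, ∀ v, v = c ∨ G.Adj c v) :
    ∃ y l l' y' m m', IsFork G y l l' ∧ IsFork G y' m m' ∧ y ≠ y' := by
  have far : ∀ r, ∃ v, 1 < G.dist r v := by
    intro r
    push Not at h
    obtain ⟨v, hv, hrv⟩ := h r
    exact ⟨v, hG.connected.one_lt_dist_of_ne_of_not_adj hv.symm hrv⟩
  obtain ⟨r⟩ := hG.connected.nonempty
  obtain ⟨v, hv⟩ := far r
  obtain ⟨y, l, l', -, hy⟩ := exists_fork_of_one_lt_dist hG hirr hv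
  obtain ⟨v', hv'⟩ := far y
  obtain ⟨y', m, m', hne, hy'⟩ := exists_fork_of_one_lt_dist hG hirr hv'
  exact ⟨y, l, l', y', m, m', hy, hy', hne.symm⟩

theorem eq_of_adj_of_universal {V : Type u} {G : SimpleGraph V} (hG : G.IsTree) {c : V}
    (hc : ∀ v, v = c ∨ G.Adj c v) {v t : V} (hv : v ≠ c) (h : G.Adj v t) : t = c := by
  by_contra ht
  have h1 := SimpleGraph.dist_eq_one_iff_adj.2 ((hc v).resolve_left hv)
  have h2 := SimpleGraph.dist_eq_one_iff_adj.2 ((hc t).resolve_left ht)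
  exact hG.dist_ne_of_adj c h (h1.trans h2.symm)

theorem isFork_of_universal {V : Type u} {G : SimpleGraph V} (hG : G.IsTree) {c : V}
    (hc : ∀ v, v = c ∨ G.Adj c v) {a b : V} (ha : a ≠ c) (hb : b ≠ c) (hab : a ≠ b) :
    IsFork G c a b :=
  ⟨(hc a).resolve_left ha, (hc b).resolve_left hb, hab,
    fun _ => eq_of_adj_of_universal hG hc ha, fun _ => eq_of_adj_of_universal hG hc hb⟩

theorem nonempty_iso_star_of_universal {V : Type u} [Finite V] {G : SimpleGraph V}
    (hG : G.IsTree) {c : V} (hc : ∀ v, v = c ∨ G.Adj c v) : ∃ n, Nonempty (G ≃g star n) := by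
  classical
  have e : {v // ¬ v = c} ≃ Fin (Nat.card {v // ¬ v = c}) := Finite.equivFin _
  have e₀ : {v // v = c} ≃ Fin 1 := Equiv.ofUnique _ _
  refine ⟨_, ⟨⟨(Equiv.sumCompl (· = c)).symm.trans (e₀.sumCongr e), fun {a b} => ?_⟩⟩⟩
  by_cases ha : a = c <;> by_cases hb : b = c
  · subst ha; subst hb
    simp
  · subst ha
    simpa [Equiv.sumCompl_symm_apply_of_neg, hb] using (hc b).resolve_left hb
  · subst hb
    simpa [Equiv.sumCompl_symm_apply_of_neg, ha] using ((hc a).resolve_left ha).symm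
  · simpa [Equiv.sumCompl_symm_apply_of_neg, ha, hb] using
      fun h => hb (eq_of_adj_of_universal hG hc ha h)

theorem star_adj {n : ℕ} {a b : Fin 1 ⊕ Fin n} :
    (star n).Adj a b ↔ a.isLeft ∧ b.isRight ∨ a.isRight ∧ b.isLeft := by
  simp [completeBipartiteGraph]

theorem IsPendantP2.of_iso {V : Type u} {W : Type w} {G : SimpleGraph V} {H : SimpleGraph W}
    (e : G ≃g H) {x y : W} (h : IsPendantP2 H x y) : IsPendantP2 G (e.symm x) (e.symm y) := by
  obtain ⟨hxy, hx, z, hzx, hyz, hy⟩ := h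
  have back : ∀ {w t}, G.Adj (e.symm w) t → H.Adj w (e t) := fun {w t} h => by
    simpa using e.map_adj_iff.2 h
  refine ⟨e.symm.map_adj_iff.2 hxy, fun t ht => ?_, e.symm z, e.symm.injective.ne hzx,
    e.symm.map_adj_iff.2 hyz, fun t ht => ?_⟩
  · rw [← hx _ (back ht), e.symm_apply_apply]
  · exact (hy _ (back ht)).imp (fun h => by rw [← h, e.symm_apply_apply])
      fun h => by rw [← h, e.symm_apply_apply]

theorem iso_P2_or_isK1OrStar {V : Type u} [Finite V] {G : SimpleGraph V} (hG : G.IsTree)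
    (hirr : IsP2Irreducible G) {c : V} (hc : ∀ v, v = c ∨ G.Adj c v) :
    Nonempty (G ≃g P2) ∨ IsK1OrStar G := by
  obtain ⟨n, ⟨e⟩⟩ := nonempty_iso_star_of_universal hG hc
  match n, e with
  | 0, e =>
    refine .inr (.inl ⟨e.trans ⟨Equiv.sumEmpty _ _, fun {a b} => ?_⟩⟩)
    rcases a with a | a
    · rcases b with b | b
      · simp [Subsingleton.elim a b]
      · exact b.elim0
    · exact a.elim0
  | 1, e =>
    refine .inl ⟨e.trans ⟨finSumFinEquiv, fun {a b} => ?_⟩⟩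
    rw [star_adj, SimpleGraph.pathGraph_adj]
    rcases a with a | a <;> rcases b with b | b <;> fin_cases a <;> fin_cases b <;>
      simp [finSumFinEquiv]
  | 2, e =>
    refine absurd (IsPendantP2.of_iso e (x := .inr 0) (y := .inl 0) ?_) (hirr _ _)
    refine ⟨by simp, fun t ht => ?_, .inr 1, by simp, by simp, fun t ht => ?_⟩
    · rcases t with t | t
      · rw [Subsingleton.elim t 0]
      · simp at ht
    · rcases t with t | t
      · simp at ht
      · fin_cases t <;> simp
  | n + 3, e => exact .inr (.inr ⟨n + 3, by omega, ⟨e⟩⟩)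

theorem outcome_eq_D_of_iso_P2 {V : Type u} [Finite V] {G : SimpleGraph V} (e : G ≃g P2) :
    outcome G = .D := by
  refine outcome_eq_D_of_pair (a := e.symm 0) (b := e.symm 1)
    (e.symm.map_adj_iff.2 (SimpleGraph.pathGraph_adj.2 (by decide))) fun v => ?_
  obtain ⟨i, rfl⟩ := e.symm.surjective v
  fin_cases i <;> simp

theorem outcome_eq_N_of_isK1OrStar {V : Type u} [Finite V] {G : SimpleGraph V}
    (h : IsK1OrStar G) : outcome G = .N := by
  rcases h with ⟨⟨e⟩⟩ | ⟨n, hn, ⟨e⟩⟩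
  · refine outcome_eq_N_of_subsingleton (c := e.symm 0) fun v => e.injective ?_
    exact Subsingleton.elim _ _
  · have univ : ∀ v, v = e.symm (.inl 0) ∨ G.Adj (e.symm (.inl 0)) v := by
      intro v
      obtain ⟨i, rfl⟩ := e.symm.surjective v
      rw [e.symm.map_adj_iff]
      rcases i with i | i
      · exact .inl (by rw [Subsingleton.elim i 0])
      · exact .inr (by simp)
    have leaf : ∀ i t, G.Adj (e.symm (.inr i)) t → t = e.symm (.inl 0) := by
      intro i t ht
      obtain ⟨j, rfl⟩ := e.symm.surjective t
      rw [e.symm.map_adj_iff] at ht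
      rcases j with j | j
      · rw [Subsingleton.elim j 0]
      · simp at ht
    refine outcome_eq_N_of_universal univ (l := e.symm (.inr ⟨0, by omega⟩))
      (l' := e.symm (.inr ⟨1, by omega⟩)) ⟨?_, ?_, ?_, leaf _, leaf _⟩
    · rw [e.symm.map_adj_iff]; simp
    · rw [e.symm.map_adj_iff]; simp
    · exact e.symm.injective.ne (by simp)

/-! ### The reduction -/

theorem IsPendantExtension.isTree {V : Type u} {W : Type w} {G : SimpleGraph V}
    {H : SimpleGraph W} {f : G ↪g H} {x y : W} {z : V} (h : IsPendantExtension f x y z)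
    (hH : H.IsTree) : G.IsTree := by
  -- the retraction that moves `x` and `y` to `z` maps edges to edges or to single vertices
  have ex : ∀ w, ∃ v, (w = x ∨ w = y) ∧ v = z ∨ f v = w := fun w => by
    rcases h.cover w with h | h | ⟨v, h⟩
    · exact ⟨z, .inl ⟨.inl h, rfl⟩⟩
    · exact ⟨z, .inl ⟨.inr h, rfl⟩⟩
    · exact ⟨v, .inr h⟩
  choose g hg using ex
  have gf : ∀ v, g (f v) = v := fun v => by
    rcases hg (f v) with ⟨h' | h', _⟩ | h'
    · exact absurd h' (h.ne_fst v)
    · exact absurd h' (h.ne_snd v)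
    · exact f.injective h'
  have gx : g x = z := (hg x).elim And.right fun h' => absurd h' (h.ne_fst _)
  have gy : g y = z := (hg y).elim And.right fun h' => absurd h' (h.ne_snd _)
  have step : ∀ a b, H.Adj a b → G.Reachable (g a) (g b) := by
    intro a b hab
    rcases h.cover a with rfl | rfl | ⟨v, rfl⟩
    · rw [h.eq_snd b hab, gx, gy]
    · rcases h.eq_or_eq b hab with rfl | rfl
      · rw [gx, gy]
      · rw [gf, gy]
    · rcases h.cover b with rfl | rfl | ⟨u, rfl⟩
      · exact absurd (h.eq_snd _ hab.symm) (h.ne_snd v)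
      · rcases h.eq_or_eq _ hab.symm with h' | h'
        · exact absurd h' (h.ne_fst v)
        · rw [h', gf, gy]
      · rw [gf, gf]
        exact (f.map_adj_iff.1 hab).reachable
  have walk : ∀ {a b}, H.Walk a b → G.Reachable (g a) (g b) := by
    intro a b p
    induction p with
    | nil => exact .refl _
    | cons hadj _ ih => exact (step _ _ hadj).trans ih
  have : Nonempty V := ⟨z⟩
  refine ⟨⟨fun a b => ?_⟩, hH.isAcyclic.embedding f⟩
  obtain ⟨p⟩ := hH.connected (f a) (f b)
  simpa [gf] using walk p

theorem RemovesPendantP2.exists_isPendantExtension {V : Type u} {T : SimpleGraph V} {s t : Set V}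
    (h : RemovesPendantP2 T s t) :
    ∃ (f : T.induce t ↪g T.induce s) (x y : s) (z : t), IsPendantExtension f x y z := by
  obtain ⟨x, y, ⟨hxy, hx, z, hzx, hyz, hy⟩, rfl⟩ := h
  have hz : z.1 ∈ s \ {x.1, y.1} := by
    refine ⟨z.2, ?_⟩
    rintro (h | h)
    · exact hzx (Subtype.ext h)
    · exact hyz.ne (Subtype.ext h.symm)
  refine ⟨SimpleGraph.induceHomOfLE T Set.sdiff_subset, x, y, ⟨z, hz⟩, ?_, ?_, ?_, hxy, hx, hy⟩
  · exact fun v h => v.2.2 (.inl (congrArg Subtype.val h))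
  · exact fun v h => v.2.2 (.inr (congrArg Subtype.val h))
  · intro w
    by_cases hwx : w = x
    · exact .inl hwx
    by_cases hwy : w = y
    · exact .inr (.inl hwy)
    refine .inr (.inr ⟨⟨w, w.2, ?_⟩, rfl⟩)
    rintro (h | h)
    · exact hwx (Subtype.ext h)
    · exact hwy (Subtype.ext h)

theorem IsP2Reduct.isTree_and_outcome_eq {V : Type u} [Finite V] {T : SimpleGraph V}
    (hT : T.IsTree) {t : Set V} (h : IsP2Reduct T t) :
    (T.induce t).IsTree ∧ outcome (T.induce t) = outcome T := by
  induction h with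
  | refl =>
    exact ⟨(SimpleGraph.induceUnivIso T).isTree_iff.2 hT,
      (outcome_eq_of_iso (SimpleGraph.induceUnivIso T)).symm⟩
  | tail _ hst ih =>
    obtain ⟨f, x, y, z, h⟩ := hst.exists_isPendantExtension
    exact ⟨h.isTree ih.1, h.outcome_eq.symm.trans ih.2⟩

theorem wellFounded_removesPendantP2 {V : Type u} [Finite V] (T : SimpleGraph V) :
    WellFounded fun t s : Set V => RemovesPendantP2 T s t := by
  refine Subrelation.wf (r := (· < ·)) (fun {t s} h => ?_) wellFounded_lt
  obtain ⟨x, y, -, rfl⟩ := h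
  exact Set.ssubset_iff_exists.2 ⟨Set.sdiff_subset, x, x.2, fun h => h.2 (.inl rfl)⟩

theorem exists_isP2Reduct_isP2Irreducible {V : Type u} [Finite V] (T : SimpleGraph V) :
    ∃ t : Set V, IsP2Reduct T t ∧ IsP2Irreducible (T.induce t) := by
  obtain ⟨t, ht, hmin⟩ := (wellFounded_removesPendantP2 T).has_min {t | IsP2Reduct T t}
    ⟨Set.univ, .refl⟩
  exact ⟨t, ht, fun x y hxy => hmin _ (ht.tail ⟨x, y, hxy, rfl⟩) ⟨x, y, hxy, rfl⟩⟩

theorem outcome_eq_S_of_not_iso {V : Type u} [Finite V] {G : SimpleGraph V} (hG : G.IsTree)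
    (hirr : IsP2Irreducible G) (h₁ : ¬ Nonempty (G ≃g P2)) (h₂ : ¬ IsK1OrStar G) :
    outcome G = .S := by
  obtain ⟨y, l, l', y', m, m', hy, hy', hne⟩ := exists_forks_of_forall_not_universal hG hirr
    fun ⟨c, hc⟩ => (iso_P2_or_isK1OrStar hG hirr hc).elim h₁ h₂
  exact outcome_eq_S_of_forks hy hy' hne

/-! ### The outcome in terms of degrees -/

/-- The vertex `v` has at least two neighbours. -/
def IsBranching {V : Type u} (G : SimpleGraph V) (v : V) : Prop :=
  ∃ a b, a ≠ b ∧ G.Adj v a ∧ G.Adj v b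

theorem IsFork.isBranching {V : Type u} {G : SimpleGraph V} {y l l' : V} (h : IsFork G y l l') :
    IsBranching G y :=
  ⟨l, l', h.ne, h.adj, h.adj'⟩

theorem exists_universal_of_isBranching_unique {V : Type u} [Finite V] {G : SimpleGraph V}
    (hG : G.IsTree) (hirr : IsP2Irreducible G)
    (h : ∀ v v', IsBranching G v → IsBranching G v' → v = v') :
    ∃ c, ∀ v, v = c ∨ G.Adj c v := by
  by_contra hcon
  obtain ⟨y, l, l', y', m, m', hy, hy', hne⟩ := exists_forks_of_forall_not_universal hG hirr hcon
  exact hne (h _ _ hy.isBranching hy'.isBranching)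

theorem outcome_eq_S_of_isBranching {V : Type u} [Finite V] {G : SimpleGraph V} (hG : G.IsTree)
    (hirr : IsP2Irreducible G) {v v' : V} (hne : v ≠ v') (hv : IsBranching G v)
    (hv' : IsBranching G v') : outcome G = .S := by
  have hnot : ¬ ∃ c, ∀ v, v = c ∨ G.Adj c v := by
    rintro ⟨c, hc⟩
    have key : ∀ w, IsBranching G w → w = c := by
      rintro w ⟨a, b, hab, ha, hb⟩
      by_contra hw
      exact hab ((eq_of_adj_of_universal hG hc hw ha).trans
        (eq_of_adj_of_universal hG hc hw hb).symm)
    exact hne ((key v hv).trans (key v' hv').symm)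
  obtain ⟨y, l, l', y', m, m', hy, hy', hne⟩ := exists_forks_of_forall_not_universal hG hirr hnot
  exact outcome_eq_S_of_forks hy hy' hne

theorem outcome_eq_N_of_isBranching {V : Type u} [Finite V] {G : SimpleGraph V} (hG : G.IsTree)
    (hirr : IsP2Irreducible G) {v : V} (hv : IsBranching G v)
    (h : ∀ v', IsBranching G v' → v' = v) : outcome G = .N := by
  obtain ⟨c, hc⟩ := exists_universal_of_isBranching_unique hG hirr
    fun w w' hw hw' => (h w hw).trans (h w' hw').symm
  obtain ⟨a, b, hab, ha, hb⟩ := hv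
  have hvc : v = c := by
    by_contra hvc
    exact hab ((eq_of_adj_of_universal hG hc hvc ha).trans
      (eq_of_adj_of_universal hG hc hvc hb).symm)
  subst hvc
  exact outcome_eq_N_of_universal hc (isFork_of_universal hG hc ha.ne.symm hb.ne.symm hab)

theorem outcome_eq_N_of_isolated {V : Type u} [Finite V] {G : SimpleGraph V} (hG : G.IsTree)
    {v : V} (hv : ∀ t, ¬ G.Adj v t) : outcome G = .N := by
  refine outcome_eq_N_of_subsingleton (c := v) fun w => by_contra fun hw => ?_
  obtain ⟨t, ht, -⟩ := exists_adj_dist_eq_dist_add_one hG (r := w) (v := v) (Ne.symm hw)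
  exact hv t ht

theorem outcome_eq_D_of_not_isBranching {V : Type u} [Finite V] {G : SimpleGraph V}
    (hG : G.IsTree) (hirr : IsP2Irreducible G) (h : ∀ v, ¬ IsBranching G v)
    (h' : ∀ v, ∃ t, G.Adj v t) : outcome G = .D := by
  obtain ⟨c, hc⟩ := exists_universal_of_isBranching_unique hG hirr fun w _ hw => absurd hw (h w)
  obtain ⟨t, ht⟩ := h' c
  refine outcome_eq_D_of_pair ht fun v => (hc v).imp_right fun hv => ?_
  by_contra hvt
  exact h c ⟨v, t, hvt, hv, ht⟩

/-! ### The sweep machine -/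

/-- The labels that the machine attaches to the vertices of the tree: `removed` if the vertex has
been removed, `deg d` if it has `d` neighbours among the remaining vertices (where `d = 3` stands
for three or more), and `chosen` if it is the vertex `y` of the pendant `P₂` that is being
removed. -/
inductive Lab where
  | removed
  | chosen
  | deg (d : Fin 4)
  deriving DecidableEq, Fintype

/-- What the machine is doing during a sweep over the adjacency matrix: computing the degrees of
the remaining vertices, looking for a pendant `P₂`, removing it, and, once there is none, looking
for a first and a second vertex of degree at least `2`, or else for a vertex of degree `0`. -/
inductive Phase where
  | count
  | find
  | remove
  | firstBranching
  | secondBranching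
  | isolated
  deriving DecidableEq

instance : Fintype Phase :=
  ⟨{.count, .find, .remove, .firstBranching, .secondBranching, .isolated},
    fun ph => by cases ph <;> decide⟩

/-- The labels whose occurrences among the neighbours of a vertex are counted. -/
def Phase.counts : Phase → Lab → Bool
  | .count, l => l ≠ .removed
  | .find, l => l = .deg 1
  | .remove, l => l = .chosen
  | _, _ => false

/-- Whether a vertex qualifies for selection, in terms of the number of counted neighbours (up to
`3`) and of its own label. In each sweep the first such vertex is selected. -/
def Phase.qualifies : Phase → Fin 4 → Lab → Bool
  | .count, _, _ => false
  | .find, d, l => l = .deg 2 ∧ d ≠ 0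
  | .remove, d, l => l = .deg 1 ∧ d ≠ 0
  | .firstBranching, _, l => l = .deg 2 ∨ l = .deg 3
  | .secondBranching, _, l => l = .deg 2 ∨ l = .deg 3
  | .isolated, _, l => l = .deg 0

/-- The new label of the selected vertex. -/
def Phase.selectedLab : Phase → Lab
  | .find => .chosen
  | _ => .removed

/-- The new label of a vertex that is not selected. -/
def Phase.unselectedLab : Phase → Fin 4 → Lab → Lab
  | .count, d, l => if l = .removed then .removed else .deg d
  | .remove, _, l => if l = .chosen then .removed else l
  | _, _, l => l

/-- The next phase, or the final answer, depending on whether a vertex has been selected. -/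
def Phase.next : Phase → Bool → Phase ⊕ Outcome
  | .count, _ => .inl .find
  | .find, true => .inl .remove
  | .find, false => .inl .firstBranching
  | .remove, _ => .inl .count
  | .firstBranching, true => .inl .secondBranching
  | .firstBranching, false => .inl .isolated
  | .secondBranching, true => .inr .S
  | .secondBranching, false => .inr .N
  | .isolated, true => .inr .N
  | .isolated, false => .inr .D

/-- The label of a vertex after a sweep, where `found` says whether an earlier vertex has been
selected. -/
def Phase.newLab (ph : Phase) (found : Bool) (d : Fin 4) (l : Lab) : Lab :=
  if ph.qualifies d l && !found then ph.selectedLab else ph.unselectedLab d l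

/-- A number, cut off at `3`. -/
def cutoff (k : ℕ) : Fin 4 := ⟨min k 3, by omega⟩

theorem cutoff_succ (k : ℕ) : cutoff (cutoff k + 1) = cutoff (k + 1) := by
  ext
  simp only [cutoff]
  omega

/-- The stacks of the machine: the adjacency matrix, split into the unread part and the reversed
read part; the labels of all columns, split in the same way; the labels of the rows still to be
read; the new labels of the rows already read, in reverse; the output. -/
inductive Stack where
  | mat
  | matRev
  | col
  | colRev
  | row
  | new
  | out
  deriving DecidableEq

instance : Fintype Stack :=
  ⟨{.mat, .matRev, .col, .colRev, .row, .new, .out}, fun k => by cases k <;> decide⟩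

/-- The alphabets of the stacks. -/
def Stack.Symbol : Stack → Type
  | .mat | .matRev => Option Bool
  | .col | .colRev | .row | .new => Lab
  | .out => Outcome

/-- The labels of the program. -/
inductive Control where
  | scan
  | restore
  | rewind
  | relabel
  | clean
  deriving DecidableEq

instance : Fintype Control :=
  ⟨{.scan, .restore, .rewind, .relabel, .clean}, fun l => by cases l <;> decide⟩

/-- The internal memory of the machine: the phase, whether a vertex has been selected in this
sweep, the number (up to `3`) of counted neighbours found in the current row, and the symbols
popped in the current step. -/
structure Memory where
  phase : Phase
  found : Bool
  count : Fin 4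
  entry : Option (Option Bool)
  lab : Option Lab

/-- The memory at the beginning of a step. -/
def memory (ph : Phase) (found : Bool) (d : Fin 4) : Memory := ⟨ph, found, d, none, none⟩

noncomputable instance : Fintype Memory :=
  Fintype.ofInjective
    (fun s : Memory => (s.phase, s.found, s.count, s.entry, s.lab)) fun s t h => by
      cases s; cases t; simpa using h

/-- The label found on top of a stack of labels. A missing label is read as that of a vertex that
has not been removed, so that the first sweep needs no preparation. -/
def topLab (l : Option Lab) : Lab := l.getD (.deg 0)

open Turing.TM2.Stmt in
/-- The program of the machine. In `scan` a row is read together with the labels of the columns,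
in `restore` these labels are put back, in `rewind` the matrix is put back at the end of a sweep,
in `relabel` the new labels replace the old ones, and in `clean` the stacks are emptied. -/
def program : Control → Turing.TM2.Stmt Stack.Symbol Control Memory
  | .scan =>
    pop .mat (fun s (x : Option (Option Bool)) => { s with entry := x }) <|
    branch (fun s => s.entry.isNone)
      (goto fun _ => .rewind) <|
    branch (fun s => s.entry = some none)
      (pop .row (fun s (x : Option Lab) => { s with lab := x }) <|
        push .new (fun s => s.phase.newLab s.found s.count (topLab s.lab)) <|
        push .matRev (fun _ => (none : Option Bool)) <|
        load (fun s => memory s.phase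
          (s.found || s.phase.qualifies s.count (topLab s.lab)) 0) <|
        goto fun _ => .restore)
      (pop .col (fun s (x : Option Lab) => { s with lab := x }) <|
        push .matRev (fun s => s.entry.getD none) <|
        push .colRev (fun s => topLab s.lab) <|
        load (fun s => memory s.phase s.found
          (if (s.entry.getD none).getD false && s.phase.counts (topLab s.lab) then
            cutoff (s.count + 1) else s.count)) <|
        goto fun _ => .scan)
  | .restore =>
    pop .colRev (fun s (x : Option Lab) => { s with lab := x }) <|
    branch (fun s => s.lab.isNone)
      (goto fun _ => .scan)
      (push .col (fun s => topLab s.lab) <|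
        load (fun s => { s with lab := none }) <|
        goto fun _ => .restore)
  | .rewind =>
    pop .matRev (fun s (x : Option (Option Bool)) => { s with entry := x }) <|
    pop .col (fun s _ => s) <|
    branch (fun s => s.entry.isNone)
      (goto fun _ => .relabel)
      (push .mat (fun s => s.entry.getD none) <|
        load (fun s => { s with entry := none }) <|
        goto fun _ => .rewind)
  | .relabel =>
    pop .new (fun s (x : Option Lab) => { s with lab := x }) <|
    branch (fun s => s.lab.isNone)
      (branch (fun s => (s.phase.next s.found).isLeft)
        (load (fun s => memory ((s.phase.next s.found).getLeft?.getD .count) false 0) <|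
          goto fun _ => .scan)
        (goto fun _ => .clean))
      (push .col (fun s => topLab s.lab) <|
        push .row (fun s => topLab s.lab) <|
        load (fun s => { s with lab := none }) <|
        goto fun _ => .relabel)
  | .clean =>
    pop .mat (fun s (x : Option (Option Bool)) => { s with entry := x }) <|
    pop .col (fun s _ => s) <|
    pop .row (fun s _ => s) <|
    branch (fun s => s.entry.isNone)
      (push .out (fun s => (s.phase.next s.found).getRight?.getD .P) <|
        load (fun _ => memory .count false 0) <|
        halt)
      (load (fun s => { s with entry := none }) <|
        goto fun _ => .clean)

/-- The contents of the stacks. -/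
def contents (A B : List (Option Bool)) (C C' R N : List Lab) (O : List Outcome) :
    ∀ k : Stack, List k.Symbol
  | .mat => A
  | .matRev => B
  | .col => C
  | .colRev => C'
  | .row => R
  | .new => N
  | .out => O

theorem step_eq_some {c c' : Turing.TM2.Cfg Stack.Symbol Control Memory}
    {c'' : Turing.TM2.Cfg Stack.Symbol Control Memory}
    (h : Turing.TM2.step program c = some c'') (hl : c''.l = c'.l) (hvar : c''.var = c'.var)
    (hstk : ∀ k, c''.stk k = c'.stk k) : Turing.TM2.step program c = some c' := by
  cases c'
  cases c''
  cases hl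
  cases hvar
  cases funext hstk
  exact h

/-- The configurations of the machine between two steps. -/
def cfg (l : Control) (ph : Phase) (found : Bool) (d : Fin 4) (A B : List (Option Bool))
    (C C' R N : List Lab) : Turing.TM2.Cfg Stack.Symbol Control Memory :=
  ⟨some l, memory ph found d, contents A B C C' R N []⟩

/-- The final configuration with output `o`. -/
def finalCfg (o : Outcome) : Turing.TM2.Cfg Stack.Symbol Control Memory :=
  ⟨none, memory .count false 0, contents [] [] [] [] [] [] [o]⟩

section steps

variable (ph : Phase) (fd : Bool) (d : Fin 4) (A B : List (Option Bool)) (C D R N : List Lab)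

theorem step_scan_bit (b : Bool) :
    Turing.TM2.step program (cfg .scan ph fd d (some b :: A) B C D R N) =
      some (cfg .scan ph fd
        (if b && ph.counts (topLab C.head?) then cutoff (d + 1) else d)
        A (some b :: B) C.tail (topLab C.head? :: D) R N) :=
  step_eq_some rfl rfl rfl fun k => by cases k <;> rfl

theorem step_scan_end :
    Turing.TM2.step program (cfg .scan ph fd d (none :: A) B C D R N) =
      some (cfg .restore ph (fd || ph.qualifies d (topLab R.head?)) 0
        A (none :: B) C D R.tail (ph.newLab fd d (topLab R.head?) :: N)) :=
  step_eq_some rfl rfl rfl fun k => by cases k <;> rfl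

theorem step_scan_nil :
    Turing.TM2.step program (cfg .scan ph fd d [] B C D R N) =
      some (cfg .rewind ph fd d [] B C D R N) :=
  step_eq_some rfl rfl rfl fun k => by cases k <;> rfl

theorem step_restore_cons (l : Lab) :
    Turing.TM2.step program (cfg .restore ph fd d A B C (l :: D) R N) =
      some (cfg .restore ph fd d A B (l :: C) D R N) :=
  step_eq_some rfl rfl rfl fun k => by cases k <;> rfl

theorem step_restore_nil :
    Turing.TM2.step program (cfg .restore ph fd d A B C [] R N) =
      some (cfg .scan ph fd d A B C [] R N) :=
  step_eq_some rfl rfl rfl fun k => by cases k <;> rfl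

theorem step_rewind_cons (x : Option Bool) :
    Turing.TM2.step program (cfg .rewind ph fd d A (x :: B) C D R N) =
      some (cfg .rewind ph fd d (x :: A) B C.tail D R N) :=
  step_eq_some rfl rfl rfl fun k => by cases k <;> rfl

theorem step_rewind_nil :
    Turing.TM2.step program (cfg .rewind ph fd d A [] C D R N) =
      some (cfg .relabel ph fd d A [] C.tail D R N) :=
  step_eq_some rfl rfl rfl fun k => by cases k <;> rfl

theorem step_relabel_cons (l : Lab) :
    Turing.TM2.step program (cfg .relabel ph fd d A B C D R (l :: N)) =
      some (cfg .relabel ph fd d A B (l :: C) D (l :: R) N) :=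
  step_eq_some rfl rfl rfl fun k => by cases k <;> rfl

theorem step_relabel_nil_inl {ph' : Phase} (h : ph.next fd = .inl ph') :
    Turing.TM2.step program (cfg .relabel ph fd d A B C D R []) =
      some (cfg .scan ph' false 0 A B C D R []) := by
  cases ph <;> cases fd <;> cases h <;>
    exact step_eq_some rfl rfl rfl fun k => by cases k <;> rfl

theorem step_relabel_nil_inr {o : Outcome} (h : ph.next fd = .inr o) :
    Turing.TM2.step program (cfg .relabel ph fd d A B C D R []) =
      some (cfg .clean ph fd d A B C D R []) := by
  cases ph <;> cases fd <;> cases h <;>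
    exact step_eq_some rfl rfl rfl fun k => by cases k <;> rfl

theorem step_clean_cons (x : Option Bool) :
    Turing.TM2.step program (cfg .clean ph fd d (x :: A) B C D R N) =
      some (cfg .clean ph fd d A B C.tail D R.tail N) :=
  step_eq_some rfl rfl rfl fun k => by cases k <;> rfl

theorem step_clean_nil {o : Outcome} (h : ph.next fd = .inr o) :
    Turing.TM2.step program (cfg .clean ph fd d [] [] [] [] [] []) = some (finalCfg o) := by
  cases ph <;> cases fd <;> cases h <;>
    exact step_eq_some rfl rfl rfl fun k => by cases k <;> rfl

end steps

/-- The machine gets from `c` to `c'` in at most `t` steps. -/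
def RunsIn (t : ℕ) (c c' : Turing.TM2.Cfg Stack.Symbol Control Memory) : Prop :=
  ∃ k ≤ t, (flip bind (Turing.TM2.step program))^[k] (some c) = some c'

theorem RunsIn.refl (c : Turing.TM2.Cfg Stack.Symbol Control Memory) : RunsIn 0 c c :=
  ⟨0, le_rfl, rfl⟩

theorem RunsIn.trans {s t : ℕ} {c c' c'' : Turing.TM2.Cfg Stack.Symbol Control Memory}
    (h : RunsIn s c c') (h' : RunsIn t c' c'') : RunsIn (s + t) c c'' := by
  obtain ⟨k, hk, hc⟩ := h
  obtain ⟨k', hk', hc'⟩ := h'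
  refine ⟨k' + k, by omega, ?_⟩
  rw [Function.iterate_add_apply, hc, hc']

theorem RunsIn.mono {s t : ℕ} {c c' : Turing.TM2.Cfg Stack.Symbol Control Memory}
    (h : RunsIn s c c') (hst : s ≤ t) : RunsIn t c c' :=
  h.imp fun _ hk => ⟨hk.1.trans hst, hk.2⟩

theorem RunsIn.single {c c' : Turing.TM2.Cfg Stack.Symbol Control Memory}
    (h : Turing.TM2.step program c = some c') : RunsIn 1 c c' :=
  ⟨1, le_rfl, h⟩

theorem RunsIn.head {t : ℕ} {c c' c'' : Turing.TM2.Cfg Stack.Symbol Control Memory}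
    (h : Turing.TM2.step program c = some c') (h' : RunsIn t c' c'') : RunsIn (t + 1) c c'' :=
  ((RunsIn.single h).trans h').mono (by omega)

/-! ### Sweeps over the adjacency matrix -/

/-- A stack holds the labels `f` of the vertices `J`; this includes the initial situation, in which
the stack is empty and no vertex has been removed. -/
def Reads {ι : Type} (C : List Lab) (J : List ι) (f : ι → Lab) : Prop :=
  C = J.map f ∨ C = [] ∧ ∀ j, f j = .deg 0

theorem Reads.top {ι : Type} {C : List Lab} {j : ι} {J : List ι} {f : ι → Lab}
    (h : Reads C (j :: J) f) : topLab C.head? = f j := by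
  rcases h with rfl | ⟨rfl, h⟩
  · rfl
  · exact (h j).symm

theorem Reads.tail {ι : Type} {C : List Lab} {j : ι} {J : List ι} {f : ι → Lab}
    (h : Reads C (j :: J) f) : Reads C.tail J f := by
  rcases h with rfl | ⟨rfl, h⟩
  · exact .inl rfl
  · exact .inr ⟨rfl, h⟩

theorem Reads.eq_nil {ι : Type} {C : List Lab} {f : ι → Lab} (h : Reads C [] f) : C = [] :=
  h.elim id And.left

theorem Reads.length_le {ι : Type} {C : List Lab} {J : List ι} {f : ι → Lab} (h : Reads C J f) :
    C.length ≤ J.length := by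
  rcases h with rfl | ⟨rfl, h⟩ <;> simp

/-- The row `i` of the matrix `a` with columns `J`, without the terminator. -/
def rowWord {ι : Type} (a : ι → ι → Bool) (J : List ι) (i : ι) : List (Option Bool) :=
  J.map fun j => some (a i j)

/-- The rows `I` of the matrix `a` with columns `J`, each followed by the terminator. -/
def matrixWord {ι : Type} (a : ι → ι → Bool) (J I : List ι) : List (Option Bool) :=
  I.flatMap fun i => rowWord a J i ++ [none]

/-- The number of neighbours of `i` with a label that is counted. -/
def Phase.numCounted {ι : Type} (ph : Phase) (a : ι → ι → Bool) (J : List ι) (f : ι → Lab)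
    (i : ι) : ℕ :=
  J.countP fun j => a i j && ph.counts (f j)

section sweep

variable {ι : Type} (ph : Phase) (a : ι → ι → Bool) (f : ι → Lab)

theorem runsIn_scan_row (fd : Bool) (i : ι) (A : List (Option Bool)) (R N : List Lab)
    (J : List ι) (k : ℕ) (B : List (Option Bool)) (C D : List Lab) (hC : Reads C J f) :
    RunsIn J.length (cfg .scan ph fd (cutoff k) (rowWord a J i ++ A) B C D R N)
      (cfg .scan ph fd (cutoff (k + ph.numCounted a J f i)) A ((rowWord a J i).reverse ++ B) []
        ((J.map f).reverse ++ D) R N) := by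
  induction J generalizing k B C D with
  | nil =>
    rw [hC.eq_nil]
    exact RunsIn.refl _
  | cons j J ih =>
    rw [show rowWord a (j :: J) i ++ A = some (a i j) :: (rowWord a J i ++ A) from rfl]
    refine .head (step_scan_bit ..) ?_
    rw [hC.top, cutoff_succ]
    have hk : (if (a i j && ph.counts (f j)) = true then cutoff (k + 1) else cutoff k) =
        cutoff (k + if (a i j && ph.counts (f j)) = true then 1 else 0) := by
      split <;> rfl
    rw [hk]
    have e : (k + if (a i j && ph.counts (f j)) = true then 1 else 0) + ph.numCounted a J f i =
        k + ph.numCounted a (j :: J) f i := by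
      simp only [Phase.numCounted, List.countP_cons]
      omega
    have h := ih (k + if (a i j && ph.counts (f j)) = true then 1 else 0) (some (a i j) :: B) _
      (f j :: D) hC.tail
    rw [e] at h
    simpa only [rowWord, List.map_cons, List.reverse_cons, List.append_assoc, List.cons_append,
      List.nil_append] using h

theorem runsIn_restore (fd : Bool) (d : Fin 4) (A B : List (Option Bool)) (R N : List Lab)
    (D C : List Lab) :
    RunsIn (D.length + 1) (cfg .restore ph fd d A B C D R N)
      (cfg .scan ph fd d A B (D.reverse ++ C) [] R N) := by
  induction D generalizing C with
  | nil => exact .single (step_restore_nil ..)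
  | cons l D ih =>
    refine .head (step_restore_cons ..) ?_
    simpa using ih (l :: C)

theorem runsIn_rewind (fd : Bool) (d : Fin 4) (R N : List Lab) (B A : List (Option Bool))
    (C : List Lab) (hC : C.length ≤ B.length) :
    RunsIn (B.length + 1) (cfg .rewind ph fd d A B C [] R N)
      (cfg .relabel ph fd d (B.reverse ++ A) [] [] [] R N) := by
  induction B generalizing A C with
  | nil =>
    rw [List.length_eq_zero_iff.1 (Nat.le_zero.1 hC)]
    exact .single (step_rewind_nil ..)
  | cons x B ih =>
    refine .head (step_rewind_cons ..) ?_
    simpa using ih (x :: A) C.tail (by simpa using hC)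

theorem runsIn_relabel (fd : Bool) (d : Fin 4) (A : List (Option Bool)) (N C R : List Lab) :
    RunsIn N.length (cfg .relabel ph fd d A [] C [] R N)
      (cfg .relabel ph fd d A [] (N.reverse ++ C) [] (N.reverse ++ R) []) := by
  induction N generalizing C R with
  | nil => exact .refl _
  | cons l N ih =>
    refine .head (step_relabel_cons ..) ?_
    simpa using ih (l :: C) (l :: R)

theorem runsIn_clean {fd : Bool} {o : Outcome} (h : ph.next fd = .inr o) (d : Fin 4)
    (A : List (Option Bool)) (C R : List Lab) (hC : C.length ≤ A.length)
    (hR : R.length ≤ A.length) :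
    RunsIn (A.length + 1) (cfg .clean ph fd d A [] C [] R []) (finalCfg o) := by
  induction A generalizing C R with
  | nil =>
    rw [List.length_eq_zero_iff.1 (Nat.le_zero.1 hC), List.length_eq_zero_iff.1 (Nat.le_zero.1 hR)]
    exact .single (step_clean_nil _ _ _ h)
  | cons x A ih =>
    exact .head (step_clean_cons ..) (ih _ _ (by simpa using hC) (by simpa using hR))

/-- The labels of the vertices `I` after a sweep, where the Boolean tells whether a vertex has been
selected before. -/
def sweepLabs (J : List ι) : Bool → List ι → List Lab
  | _, [] => []
  | fd, i :: I =>
    ph.newLab fd (cutoff (ph.numCounted a J f i)) (f i) ::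
      sweepLabs J (fd || ph.qualifies (cutoff (ph.numCounted a J f i)) (f i)) I

/-- The vertex `i` qualifies for selection in the sweep. -/
def Phase.Qualifies (J : List ι) (i : ι) : Prop :=
  ph.qualifies (cutoff (ph.numCounted a J f i)) (f i)

theorem runsIn_scan (J I : List ι) (fd : Bool) (B : List (Option Bool)) (C R N : List Lab)
    (hC : Reads C J f) (hR : Reads R I f) :
    ∃ C', Reads C' J f ∧
      RunsIn (I.length * (2 * J.length + 2) + 1)
        (cfg .scan ph fd 0 (matrixWord a J I) B C [] R N)
        (cfg .rewind ph
          (fd || I.any fun i => ph.qualifies (cutoff (ph.numCounted a J f i)) (f i)) 0 []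
          ((matrixWord a J I).reverse ++ B) C' [] [] ((sweepLabs ph a f J fd I).reverse ++ N)) := by
  induction I generalizing fd B C R N with
  | nil =>
    refine ⟨C, hC, ?_⟩
    rw [hR.eq_nil]
    simpa [matrixWord, sweepLabs] using RunsIn.single (step_scan_nil ph fd 0 B C [] [] N)
  | cons i I ih =>
    obtain ⟨C', hC', h⟩ := ih
      (fd || ph.qualifies (cutoff (ph.numCounted a J f i)) (f i))
      (none :: ((rowWord a J i).reverse ++ B)) (J.map f) R.tail
      (ph.newLab fd (cutoff (ph.numCounted a J f i)) (f i) :: N) (.inl rfl) hR.tail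
    refine ⟨C', hC', ?_⟩
    have h₁ := runsIn_scan_row ph a f fd i (none :: matrixWord a J I) R N J 0 B C [] hC
    have h₂ := RunsIn.single (step_scan_end ph fd (cutoff (0 + ph.numCounted a J f i))
      (matrixWord a J I) ((rowWord a J i).reverse ++ B) [] ((J.map f).reverse ++ []) R N)
    have h₃ := runsIn_restore ph
      (fd || ph.qualifies (cutoff (ph.numCounted a J f i)) (f i)) 0 (matrixWord a J I)
      (none :: ((rowWord a J i).reverse ++ B)) R.tail
      (ph.newLab fd (cutoff (ph.numCounted a J f i)) (f i) :: N) (J.map f).reverse []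
    rw [hR.top] at h₂
    simp only [zero_add, List.append_nil, List.reverse_reverse] at h₁ h₂ h₃
    have h₄ := ((h₁.trans h₂).trans h₃).trans h
    have e₁ : matrixWord a J (i :: I) = rowWord a J i ++ none :: matrixWord a J I := by
      simp [matrixWord]
    have e₂ : cutoff 0 = 0 := rfl
    rw [e₂] at h₄
    rw [e₁]
    refine RunsIn.mono (s := J.length + 1 + (J.length + 1) + (I.length * (2 * J.length + 2) + 1))
      ?_ (by simp only [List.length_cons]; ring_nf; omega)
    simpa only [sweepLabs, List.any_cons, Bool.or_assoc, List.reverse_append, List.reverse_cons,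
      List.append_assoc, List.cons_append, List.nil_append, List.length_reverse,
      List.length_map] using h₄

theorem sweepLabs_true (J I : List ι) :
    sweepLabs ph a f J true I =
      I.map fun i => ph.unselectedLab (cutoff (ph.numCounted a J f i)) (f i) := by
  induction I with
  | nil => rfl
  | cons i I ih => simp [sweepLabs, Phase.newLab, ih]

theorem sweepLabs_of_forall_not (J I : List ι) (h : ∀ i ∈ I, ¬ ph.Qualifies a f J i) :
    sweepLabs ph a f J false I =
      I.map fun i => ph.unselectedLab (cutoff (ph.numCounted a J f i)) (f i) := by
  induction I with
  | nil => rfl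
  | cons i I ih =>
    have hi := h i (by simp)
    rw [Phase.Qualifies, Bool.not_eq_true] at hi
    simp [sweepLabs, Phase.newLab, hi, ih fun i hi => h i (by simp [hi])]

theorem sweepLabs_of_exists [DecidableEq ι] (J I : List ι) (hI : I.Nodup)
    (h : ∃ i ∈ I, ph.Qualifies a f J i) :
    ∃ i ∈ I, ph.Qualifies a f J i ∧ sweepLabs ph a f J false I =
      I.map (Function.update
        (fun i => ph.unselectedLab (cutoff (ph.numCounted a J f i)) (f i)) i ph.selectedLab) := by
  induction I with
  | nil => simp at h
  | cons i I ih =>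
    rw [List.nodup_cons] at hI
    by_cases hi : ph.Qualifies a f J i
    · refine ⟨i, by simp, hi, ?_⟩
      rw [Phase.Qualifies] at hi
      rw [sweepLabs, hi, Bool.or_true, sweepLabs_true, List.map_cons, Function.update_self]
      congr 1
      · simp [Phase.newLab, hi]
      · refine List.map_congr_left fun k hk => ?_
        have hk' : k ≠ i := by rintro rfl; exact hI.1 hk
        rw [Function.update_of_ne hk']
    · obtain ⟨i', hi', hq⟩ := h
      have hi'I : i' ∈ I := (List.mem_cons.1 hi').resolve_left (by rintro rfl; exact hi hq)
      obtain ⟨k, hk, hkq, e⟩ := ih hI.2 ⟨i', hi'I, hq⟩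
      refine ⟨k, by simp [hk], hkq, ?_⟩
      have hik : i ≠ k := by rintro rfl; exact hI.1 hk
      rw [Phase.Qualifies, Bool.not_eq_true] at hi
      simp only [sweepLabs, Phase.newLab, hi, List.map_cons, Function.update_of_ne hik]
      simpa using e

theorem length_matrixWord (J I : List ι) :
    (matrixWord a J I).length = I.length * (J.length + 1) := by
  induction I with
  | nil => simp [matrixWord]
  | cons i I ih =>
    rw [matrixWord, List.flatMap_cons, List.length_append, ← matrixWord, ih]
    simp [rowWord]
    ring

/-- The configuration at the beginning of a sweep of the matrix `a` with vertices `J` labelled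
by `f`. -/
def startCfg (J : List ι) (C R : List Lab) : Turing.TM2.Cfg Stack.Symbol Control Memory :=
  cfg .scan ph false 0 (matrixWord a J J) [] C [] R []

/-- A bound for the number of steps of a sweep, and of the final cleaning. -/
def sweepTime (J : List ι) : ℕ := 4 * (J.length * (J.length + 1)) + 4

theorem runsIn_sweep (J : List ι) {C R : List Lab} (hC : Reads C J f) (hR : Reads R J f) :
    RunsIn (J.length * (2 * J.length + 2) + 1 + (J.length * (J.length + 1) + 1) + J.length)
      (startCfg ph a J C R)
      (cfg .relabel ph (J.any fun i => ph.qualifies (cutoff (ph.numCounted a J f i)) (f i)) 0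
        (matrixWord a J J) [] (sweepLabs ph a f J false J) [] (sweepLabs ph a f J false J) []) := by
  obtain ⟨C', hC', h₁⟩ := runsIn_scan ph a f J J false [] C R [] hC hR
  have h₂ := runsIn_rewind ph
    (false || J.any fun i => ph.qualifies (cutoff (ph.numCounted a J f i)) (f i)) 0 []
    ((sweepLabs ph a f J false J).reverse ++ []) ((matrixWord a J J).reverse ++ []) [] C' (by
      have := hC'.length_le
      simp only [List.append_nil, List.length_reverse, length_matrixWord]
      nlinarith)
  have h₃ := runsIn_relabel ph
    (false || J.any fun i => ph.qualifies (cutoff (ph.numCounted a J f i)) (f i)) 0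
    (((matrixWord a J J).reverse ++ []).reverse ++ [])
    ((sweepLabs ph a f J false J).reverse ++ []) [] []
  have hlen : ∀ (I : List ι) (fd : Bool), (sweepLabs ph a f J fd I).length = I.length := by
    intro I
    induction I with
    | nil => intro; rfl
    | cons i I ih => intro fd; simp [sweepLabs, ih]
  have h := (h₁.trans h₂).trans h₃
  simpa [startCfg, length_matrixWord, hlen] using h

/-- A sweep either finds no vertex that qualifies, or it selects one. -/
theorem sweep_cases [DecidableEq ι] (J : List ι) (hJ : J.Nodup) (hmem : ∀ i, i ∈ J)
    {C R : List Lab} (hC : Reads C J f) (hR : Reads R J f) :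
    ∃ (found : Bool) (f' : ι → Lab),
      (found = false ∧ (∀ i, ¬ ph.Qualifies a f J i) ∧
          f' = (fun i => ph.unselectedLab (cutoff (ph.numCounted a J f i)) (f i)) ∨
        found = true ∧ ∃ i, ph.Qualifies a f J i ∧
          f' = Function.update
            (fun i => ph.unselectedLab (cutoff (ph.numCounted a J f i)) (f i)) i
            ph.selectedLab) ∧
      (∀ ph', ph.next found = .inl ph' →
        RunsIn (sweepTime J) (startCfg ph a J C R)
          (startCfg ph' a J (J.map f') (J.map f'))) ∧
      ∀ o, ph.next found = .inr o →
        RunsIn (sweepTime J + sweepTime J) (startCfg ph a J C R) (finalCfg o) := by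
  have h := runsIn_sweep ph a f J hC hR
  have key : ∀ (found : Bool) (f' : ι → Lab),
      (J.any fun i => ph.qualifies (cutoff (ph.numCounted a J f i)) (f i)) = found →
      sweepLabs ph a f J false J = J.map f' →
      (∀ ph', ph.next found = .inl ph' →
        RunsIn (sweepTime J) (startCfg ph a J C R)
          (startCfg ph' a J (J.map f') (J.map f'))) ∧
      ∀ o, ph.next found = .inr o →
        RunsIn (sweepTime J + sweepTime J) (startCfg ph a J C R) (finalCfg o) := by
    intro found f' hfound hf'
    rw [hfound, hf'] at h
    have htime : J.length * (2 * J.length + 2) + 1 + (J.length * (J.length + 1) + 1) + J.length + 1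
        ≤ sweepTime J := by
      simp only [sweepTime]
      nlinarith
    refine ⟨fun ph' hph' => ?_, fun o ho => ?_⟩
    · exact (h.trans (.single (step_relabel_nil_inl _ _ _ _ _ _ _ _ hph'))).mono htime
    · refine ((h.trans (.single (step_relabel_nil_inr _ _ _ _ _ _ _ _ ho))).mono htime).trans ?_
      have hl : (J.map f').length ≤ (matrixWord a J J).length := by
        rw [length_matrixWord, List.length_map]
        nlinarith
      refine (runsIn_clean ph ho 0 (matrixWord a J J) _ _ hl hl).mono ?_
      rw [length_matrixWord, sweepTime]
      omega
  by_cases hex : ∃ i, ph.Qualifies a f J i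
  · obtain ⟨i, -, hi, e⟩ := sweepLabs_of_exists ph a f J J hJ
      (hex.imp fun i hi => ⟨hmem i, hi⟩)
    exact ⟨true, _, .inr ⟨rfl, i, hi, rfl⟩, key _ _ (List.any_eq_true.2 ⟨i, hmem i, hi⟩) e⟩
  · have hex' := not_exists.1 hex
    refine ⟨false, _, .inl ⟨rfl, hex', rfl⟩, key _ _ ?_ (sweepLabs_of_forall_not ph a f J J
      fun i _ => hex' i)⟩
    rw [List.any_eq_false]
    exact fun i _ => hex' i

end sweep

/-! ### Correctness of the algorithm -/

theorem cutoff_eq_zero {k : ℕ} : cutoff k = 0 ↔ k = 0 := by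
  simp only [Fin.ext_iff, cutoff, Fin.val_zero]
  omega

theorem cutoff_eq_one {k : ℕ} : cutoff k = 1 ↔ k = 1 := by
  simp only [Fin.ext_iff, cutoff, Fin.val_one]
  omega

theorem cutoff_eq_two {k : ℕ} : cutoff k = 2 ↔ k = 2 := by
  simp only [Fin.ext_iff, cutoff, Fin.val_two]
  omega

theorem cutoff_eq_two_or_three {k : ℕ} : cutoff k = 2 ∨ cutoff k = 3 ↔ 1 < k := by
  have h : ((3 : Fin 4) : ℕ) = 3 := rfl
  simp only [Fin.ext_iff, cutoff, Fin.val_two, h]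
  omega

section degree

open Classical in
/-- The neighbours of `i` in the set `s`. -/
noncomputable def neighborsIn {V : Type} [Fintype V] (T : SimpleGraph V) (s : Set V) (i : V) :
    Finset V :=
  Finset.univ.filter fun j => T.Adj i j ∧ j ∈ s

theorem mem_neighborsIn {V : Type} [Fintype V] {T : SimpleGraph V} {s : Set V} {i j : V} :
    j ∈ neighborsIn T s i ↔ T.Adj i j ∧ j ∈ s := by
  simp [neighborsIn]

variable {V : Type} [Fintype V] {T : SimpleGraph V} {s : Set V}

theorem isPendantP2_induce_iff {x y : s} :
    IsPendantP2 (T.induce s) x y ↔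
      T.Adj x y ∧ (neighborsIn T s x).card = 1 ∧ (neighborsIn T s y).card = 2 := by
  classical
  constructor
  · rintro ⟨hxy, hx, z, hzx, hyz, hy⟩
    refine ⟨hxy, Finset.card_eq_one.2 ⟨y, ?_⟩, Finset.card_eq_two.2 ⟨x, z, ?_, ?_⟩⟩
    · ext t
      rw [mem_neighborsIn, Finset.mem_singleton]
      constructor
      · exact fun ht => congrArg Subtype.val (hx ⟨t, ht.2⟩ ht.1)
      · rintro rfl
        exact ⟨hxy, y.2⟩
    · exact fun h => hzx (Subtype.ext h.symm)
    · ext t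
      rw [mem_neighborsIn, Finset.mem_insert, Finset.mem_singleton]
      constructor
      · exact fun ht => (hy ⟨t, ht.2⟩ ht.1).imp (congrArg Subtype.val) (congrArg Subtype.val)
      · rintro (rfl | rfl)
        · exact ⟨hxy.symm, x.2⟩
        · exact ⟨hyz, z.2⟩
  · rintro ⟨hxy, hx, hy⟩
    have hxy' : y.1 ∈ neighborsIn T s x := mem_neighborsIn.2 ⟨hxy, y.2⟩
    have hyx' : x.1 ∈ neighborsIn T s y := mem_neighborsIn.2 ⟨hxy.symm, x.2⟩
    obtain ⟨z, hz, hzx⟩ := Finset.exists_mem_ne (by omega) x.1 (s := neighborsIn T s y)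
    have hz' := mem_neighborsIn.1 hz
    refine ⟨hxy, fun t ht => ?_, ⟨z, hz'.2⟩, fun h => hzx (congrArg Subtype.val h), hz'.1,
      fun t ht => ?_⟩
    · exact Subtype.ext (Finset.card_le_one.1 hx.le t (mem_neighborsIn.2 ⟨ht, t.2⟩) y hxy')
    · by_contra hcon
      push Not at hcon
      have h3 : 2 < (neighborsIn T s y).card := Finset.two_lt_card.2
        ⟨x, hyx', z, hz, t, mem_neighborsIn.2 ⟨ht, t.2⟩, hzx.symm,
          fun h => hcon.1 (Subtype.ext h.symm), fun h => hcon.2 (Subtype.ext h.symm)⟩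
      omega

theorem isBranching_induce_iff {x : s} :
    IsBranching (T.induce s) x ↔ 1 < (neighborsIn T s x).card := by
  rw [Finset.one_lt_card]
  constructor
  · rintro ⟨a, b, hab, ha, hb⟩
    exact ⟨a, mem_neighborsIn.2 ⟨ha, a.2⟩, b, mem_neighborsIn.2 ⟨hb, b.2⟩,
      fun h => hab (Subtype.ext h)⟩
  · rintro ⟨a, ha, b, hb, hab⟩
    rw [mem_neighborsIn] at ha hb
    exact ⟨⟨a, ha.2⟩, ⟨b, hb.2⟩, fun h => hab (congrArg Subtype.val h), ha.1, hb.1⟩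

theorem forall_not_adj_induce_iff {x : s} :
    (∀ t, ¬ (T.induce s).Adj x t) ↔ (neighborsIn T s x).card = 0 := by
  rw [Finset.card_eq_zero, Finset.eq_empty_iff_forall_notMem]
  exact ⟨fun h t ht => h ⟨t, (mem_neighborsIn.1 ht).2⟩ (mem_neighborsIn.1 ht).1,
    fun h t ht => h t (mem_neighborsIn.2 ⟨ht, t.2⟩)⟩

end degree

/-- The adjacency matrix of a graph. -/
noncomputable def adjBool {V : Type} (T : SimpleGraph V) (i j : V) : Bool :=
  open Classical in decide (T.Adj i j)

theorem adjBool_eq_true {V : Type} {T : SimpleGraph V} {i j : V} :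
    adjBool T i j = true ↔ T.Adj i j := by
  simp [adjBool]

theorem numCounted_count {n : ℕ} (T : SimpleGraph (Fin n)) (f : Fin n → Lab) (i : Fin n) :
    Phase.count.numCounted (adjBool T) (List.finRange n) f i =
      (neighborsIn T {j | f j ≠ .removed} i).card := by
  classical
  rw [Phase.numCounted, List.countP_eq_length_filter, ← List.toFinset_card_of_nodup
    ((List.nodup_finRange n).filter _)]
  congr 1
  ext j
  simp [mem_neighborsIn, Phase.counts, adjBool_eq_true]

theorem cutoff_numCounted_ne_zero {n : ℕ} {ph : Phase} {T : SimpleGraph (Fin n)}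
    {f : Fin n → Lab} {i : Fin n} :
    cutoff (ph.numCounted (adjBool T) (List.finRange n) f i) ≠ 0 ↔
      ∃ j, T.Adj i j ∧ ph.counts (f j) := by
  rw [Ne, cutoff_eq_zero, ← Ne, ← Nat.pos_iff_ne_zero, Phase.numCounted, List.countP_pos_iff]
  simp [adjBool_eq_true]

/-- The labelling `f` marks the vertices outside `s` as removed, and labels those of `s` by their
degrees. -/
def IsDegreeLabelling {n : ℕ} (T : SimpleGraph (Fin n)) (s : Set (Fin n)) (f : Fin n → Lab) :
    Prop :=
  ∀ i, (i ∉ s → f i = .removed) ∧ (i ∈ s → f i = .deg (cutoff (neighborsIn T s i).card))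

namespace IsDegreeLabelling

variable {n : ℕ} {T : SimpleGraph (Fin n)} {s : Set (Fin n)} {f : Fin n → Lab}

theorem mem_of_eq_deg (h : IsDegreeLabelling T s f) {i : Fin n} {d : Fin 4} (hi : f i = .deg d) :
    i ∈ s := by
  by_contra hs
  rw [(h i).1 hs] at hi
  cases hi

theorem ne_chosen (h : IsDegreeLabelling T s f) (i : Fin n) : f i ≠ .chosen := by
  by_cases hi : i ∈ s
  · rw [(h i).2 hi]; simp
  · rw [(h i).1 hi]; simp

theorem eq_removed_iff (h : IsDegreeLabelling T s f) (i : Fin n) : f i = .removed ↔ i ∉ s := by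
  by_cases hi : i ∈ s
  · simp [(h i).2 hi, hi]
  · simp [(h i).1 hi, hi]

theorem isBranching_iff (h : IsDegreeLabelling T s f) (x : s) :
    IsBranching (T.induce s) x ↔ f x = .deg 2 ∨ f x = .deg 3 := by
  rw [isBranching_induce_iff, ← cutoff_eq_two_or_three, (h x).2 x.2, Lab.deg.injEq, Lab.deg.injEq]

theorem forall_not_adj_iff (h : IsDegreeLabelling T s f) (x : s) :
    (∀ t, ¬ (T.induce s).Adj x t) ↔ f x = .deg 0 := by
  rw [forall_not_adj_induce_iff, ← cutoff_eq_zero, (h x).2 x.2, Lab.deg.injEq]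

theorem isPendantP2_iff (h : IsDegreeLabelling T s f) {x y : s} :
    IsPendantP2 (T.induce s) x y ↔ T.Adj x y ∧ f x = .deg 1 ∧ f y = .deg 2 := by
  rw [isPendantP2_induce_iff, ← cutoff_eq_one, ← cutoff_eq_two, (h x).2 x.2, (h y).2 y.2,
    Lab.deg.injEq, Lab.deg.injEq]

theorem of_count (T : SimpleGraph (Fin n)) (f : Fin n → Lab) :
    IsDegreeLabelling T {i | f i ≠ .removed} fun i =>
      Phase.count.unselectedLab
        (cutoff (Phase.count.numCounted (adjBool T) (List.finRange n) f i)) (f i) := by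
  intro i
  beta_reduce
  rw [numCounted_count]
  constructor <;> intro hi
  · simp [Phase.unselectedLab, not_not.1 hi]
  · simp [Phase.unselectedLab, show f i ≠ .removed from hi]

end IsDegreeLabelling

/-- Once no pendant `P₂` is left, the outcome is found by counting the vertices with more than one
neighbour. -/
theorem runsIn_of_irreducible {n : ℕ} {T : SimpleGraph (Fin n)} {s : Set (Fin n)}
    {f : Fin n → Lab} (hf : IsDegreeLabelling T s f) (hs : (T.induce s).IsTree)
    (hirr : IsP2Irreducible (T.induce s)) :
    RunsIn (3 * sweepTime (List.finRange n))
      (startCfg .firstBranching (adjBool T) (List.finRange n) ((List.finRange n).map f)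
        ((List.finRange n).map f))
      (finalCfg (outcome (T.induce s))) := by
  have hJ := List.nodup_finRange n
  have hmem : ∀ i : Fin n, i ∈ List.finRange n := List.mem_finRange
  have branching : ∀ x : s, IsBranching (T.induce s) x →
      Phase.firstBranching.Qualifies (adjBool T) f (List.finRange n) x := fun x hx => by
    simpa [Phase.Qualifies, Phase.qualifies] using (hf.isBranching_iff x).1 hx
  obtain ⟨fd, f₁, h | ⟨rfl, i, hi, hf₁⟩, h₁, -⟩ :=
    sweep_cases .firstBranching (adjBool T) f _ hJ hmem (.inl rfl) (.inl rfl)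
  · obtain ⟨rfl, hno, hf₁⟩ := h
    obtain rfl : f₁ = f := hf₁
    have hnb : ∀ x, ¬ IsBranching (T.induce s) x := fun x hx => hno x (branching x hx)
    obtain ⟨fd, f₂, h | ⟨rfl, i, hi, -⟩, -, h₂⟩ :=
      sweep_cases .isolated (adjBool T) f₁ _ hJ hmem (.inl rfl) (.inl rfl)
    · obtain ⟨rfl, hno', -⟩ := h
      rw [outcome_eq_D_of_not_isBranching hs hirr hnb fun x => ?_]
      · exact ((h₁ _ rfl).trans (h₂ _ rfl)).mono (by omega)
      · by_contra hx
        refine hno' x ?_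
        simpa [Phase.Qualifies, Phase.qualifies] using
          (hf.forall_not_adj_iff x).1 (not_exists.1 hx)
    · have hi' : f₁ i = .deg 0 := by simpa [Phase.Qualifies, Phase.qualifies] using hi
      rw [outcome_eq_N_of_isolated hs
        ((hf.forall_not_adj_iff ⟨i, hf.mem_of_eq_deg hi'⟩).2 hi')]
      exact ((h₁ _ rfl).trans (h₂ _ rfl)).mono (by omega)
  · have hi' : f i = .deg 2 ∨ f i = .deg 3 := by
      simpa [Phase.Qualifies, Phase.qualifies] using hi
    have his : i ∈ s := hi'.elim hf.mem_of_eq_deg hf.mem_of_eq_deg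
    have hib : IsBranching (T.induce s) ⟨i, his⟩ := (hf.isBranching_iff ⟨i, his⟩).2 hi'
    replace hf₁ : f₁ = Function.update f i .removed := hf₁
    obtain ⟨fd, f₂, h | ⟨rfl, k, hk, -⟩, -, h₂⟩ :=
      sweep_cases .secondBranching (adjBool T) f₁ _ hJ hmem (.inl rfl) (.inl rfl)
    · obtain ⟨rfl, hno, -⟩ := h
      rw [outcome_eq_N_of_isBranching hs hirr hib fun x hx => ?_]
      · exact ((h₁ _ rfl).trans (h₂ _ rfl)).mono (by omega)
      · by_contra hxi
        have hxi' : x.1 ≠ i := fun h => hxi (Subtype.ext h)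
        refine hno x ?_
        simpa [Phase.Qualifies, Phase.qualifies, hf₁, hxi'] using (hf.isBranching_iff x).1 hx
    · have hk' : f₁ k = .deg 2 ∨ f₁ k = .deg 3 := by
        simpa [Phase.Qualifies, Phase.qualifies] using hk
      have hki : k ≠ i := by
        rintro rfl
        simp [hf₁] at hk'
      rw [hf₁, Function.update_of_ne hki] at hk'
      have hks : k ∈ s := hk'.elim hf.mem_of_eq_deg hf.mem_of_eq_deg
      rw [outcome_eq_S_of_isBranching hs hirr (v := ⟨k, hks⟩) (v' := ⟨i, his⟩)
        (fun h => hki (congrArg Subtype.val h)) ((hf.isBranching_iff ⟨k, hks⟩).2 hk') hib]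
      exact ((h₁ _ rfl).trans (h₂ _ rfl)).mono (by omega)

/-- Three sweeps remove a pendant `P₂`, as long as there is one. -/
theorem runsIn_of_isP2Reduct {n : ℕ} {T : SimpleGraph (Fin n)} (hT : T.IsTree) (m : ℕ)
    {f : Fin n → Lab} (hf : IsP2Reduct T {i | f i ≠ .removed})
    (hm : {i | f i ≠ .removed}.ncard ≤ m) {C R : List Lab}
    (hC : Reads C (List.finRange n) f) (hR : Reads R (List.finRange n) f) :
    RunsIn ((3 * m + 5) * sweepTime (List.finRange n))
      (startCfg .count (adjBool T) (List.finRange n) C R) (finalCfg (outcome T)) := by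
  induction m using Nat.strong_induction_on generalizing f C R with | _ m ih => ?_
  have hJ := List.nodup_finRange n
  have hmem : ∀ i : Fin n, i ∈ List.finRange n := List.mem_finRange
  have hs := hf.isTree_and_outcome_eq hT
  obtain ⟨fd, f₁, h | ⟨-, i, hi, -⟩, h₁, -⟩ :=
    sweep_cases .count (adjBool T) f _ hJ hmem hC hR
  swap
  · exact absurd hi (by simp [Phase.Qualifies, Phase.qualifies])
  obtain ⟨rfl, -, rfl⟩ := h
  have hdeg := IsDegreeLabelling.of_count T f
  revert h₁ hdeg
  generalize (fun i => Phase.count.unselectedLab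
    (cutoff (Phase.count.numCounted (adjBool T) (List.finRange n) f i)) (f i)) = f₁
  intro h₁ hdeg
  obtain ⟨fd, f₂, h | ⟨rfl, y, hy, hf₂⟩, h₂, -⟩ :=
    sweep_cases .find (adjBool T) f₁ _ hJ hmem (.inl rfl) (.inl rfl)
  · obtain ⟨rfl, hno, hf₂⟩ := h
    obtain rfl : f₂ = f₁ := hf₂
    have hirr : IsP2Irreducible (T.induce {i | f i ≠ .removed}) := by
      intro x y hxy
      rw [hdeg.isPendantP2_iff] at hxy
      refine hno y ?_
      simp only [Phase.Qualifies, Phase.qualifies, decide_eq_true_eq]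
      refine ⟨hxy.2.2, cutoff_numCounted_ne_zero.2 ⟨x, hxy.1.symm, ?_⟩⟩
      simpa [Phase.counts] using hxy.2.1
    have h₃ := runsIn_of_irreducible hdeg hs.1 hirr
    rw [hs.2] at h₃
    exact (((h₁ _ rfl).trans (h₂ _ rfl)).trans h₃).mono (by nlinarith)
  · replace hf₂ : f₂ = Function.update f₁ y .chosen := hf₂
    simp only [Phase.Qualifies, Phase.qualifies, decide_eq_true_eq] at hy
    obtain ⟨hy, hx⟩ := hy
    rw [cutoff_numCounted_ne_zero] at hx
    obtain ⟨x₀, hyx₀, hx₀⟩ := hx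
    replace hx₀ : f₁ x₀ = .deg 1 := by simpa [Phase.counts] using hx₀
    have hchosen : ∀ i, f₂ i = .chosen ↔ i = y := by
      intro i
      by_cases hi : i = y
      · simp [hf₂, hi]
      · simp [hf₂, hi, hdeg.ne_chosen]
    obtain ⟨fd, f₃, h | ⟨rfl, x, hx, hf₃⟩, h₃, -⟩ :=
      sweep_cases .remove (adjBool T) f₂ _ hJ hmem (.inl rfl) (.inl rfl)
    · refine absurd ?_ (h.2.1 x₀)
      simp only [Phase.Qualifies, Phase.qualifies, decide_eq_true_eq]
      refine ⟨by rw [hf₂, Function.update_of_ne hyx₀.ne.symm, hx₀],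
        cutoff_numCounted_ne_zero.2 ⟨y, hyx₀.symm, ?_⟩⟩
      simpa [Phase.counts] using (hchosen y).2 rfl
    · simp only [Phase.Qualifies, Phase.qualifies, decide_eq_true_eq] at hx
      obtain ⟨hx, hxy⟩ := hx
      rw [cutoff_numCounted_ne_zero] at hxy
      obtain ⟨j, hxy, hj⟩ := hxy
      obtain rfl : j = y := (hchosen j).1 (by simpa [Phase.counts] using hj)
      rw [hf₂, Function.update_of_ne hxy.ne] at hx
      have hxs := hdeg.mem_of_eq_deg hx
      have hjs := hdeg.mem_of_eq_deg hy
      have hpend : IsPendantP2 (T.induce {i | f i ≠ .removed}) ⟨x, hxs⟩ ⟨j, hjs⟩ :=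
        hdeg.isPendantP2_iff.2 ⟨hxy, hx, hy⟩
      have hrest : {i | f₃ i ≠ .removed} = {i | f i ≠ .removed} \ {x, j} := by
        ext i
        have h0 := hdeg.eq_removed_iff i
        by_cases hix : i = x
        · simp [hf₃, hix, Phase.selectedLab]
        · by_cases hij : i = j
          · simp [hf₃, hij, hxy.ne.symm, Phase.unselectedLab, (hchosen j).2 rfl]
          · have h2 : f₂ i = f₁ i := by rw [hf₂, Function.update_of_ne hij]
            simp [hf₃, hix, hij, Phase.unselectedLab, h2, hdeg.ne_chosen i, h0]
      have hrem : RemovesPendantP2 T {i | f i ≠ .removed} {i | f₃ i ≠ .removed} :=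
        ⟨_, _, hpend, hrest⟩
      have hlt : {i | f₃ i ≠ .removed}.ncard < {i | f i ≠ .removed}.ncard := by
        rw [hrest]
        exact Set.ncard_lt_ncard (Set.ssubset_iff_exists.2
          ⟨Set.sdiff_subset, x, hxs, fun h => h.2 (.inl rfl)⟩) (Set.toFinite _)
      obtain ⟨m, rfl⟩ : ∃ k, m = k + 1 := ⟨m - 1, by omega⟩
      have h₄ := ih m (by omega) (hf.tail hrem) (by omega) (C := (List.finRange n).map f₃)
        (R := (List.finRange n).map f₃) (.inl rfl) (.inl rfl)
      exact ((((h₁ _ rfl).trans (h₂ _ rfl)).trans (h₃ _ rfl)).trans h₄).mono (by nlinarith)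

/-- The sweep machine as a bundled machine, with the adjacency matrix as its input. -/
noncomputable def sweepMachine : Turing.FinTM2 where
  K := Stack
  k₀ := .mat
  k₁ := .out
  Γ := Stack.Symbol
  Λ := Control
  main := .scan
  σ := Memory
  initialState := memory .count false 0
  Γk₀Fin := inferInstanceAs (Fintype (Option Bool))
  m := program

theorem encodeTree_eq_matrixWord (T : LabelledTree) :
    encodeTree T = matrixWord (adjBool T.graph) (List.finRange T.n) (List.finRange T.n) :=
  rfl

theorem initList_sweepMachine (s : List (Option Bool)) :
    Turing.initList sweepMachine s = cfg .scan .count false 0 s [] [] [] [] [] := by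
  have h : (Turing.initList sweepMachine s).stk = contents s [] [] [] [] [] [] := by
    funext k
    cases k <;> rfl
  exact congrArg (Turing.TM2.Cfg.mk _ _) h

theorem haltList_sweepMachine (o : Outcome) :
    Turing.haltList sweepMachine [o] = finalCfg o := by
  have h : (Turing.haltList sweepMachine [o]).stk = contents [] [] [] [] [] [] [o] := by
    funext k
    cases k <;> rfl
  exact congrArg (Turing.TM2.Cfg.mk _ _) h

theorem runsIn_outcome (T : LabelledTree) :
    RunsIn ((3 * (encodeTree T).length + 5) * (4 * (encodeTree T).length + 4))
      (cfg .scan .count false 0 (encodeTree T) [] [] [] [] []) (finalCfg (outcome T.graph)) := by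
  have hrest : {i : Fin T.n | (fun _ => Lab.deg 0 : Fin T.n → Lab) i ≠ .removed} = Set.univ := by
    ext i; simp
  have h := runsIn_of_isP2Reduct T.isTree T.n (f := fun _ => .deg 0)
    (by rw [hrest]; exact .refl)
    (by rw [hrest, Set.ncard_univ, Nat.card_fin]) (C := []) (R := [])
    (.inr ⟨rfl, fun _ => rfl⟩) (.inr ⟨rfl, fun _ => rfl⟩)
  have hlen : (encodeTree T).length = T.n * (T.n + 1) := by
    rw [encodeTree_eq_matrixWord, length_matrixWord, List.length_finRange]
  refine RunsIn.mono h ?_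
  rw [sweepTime, List.length_finRange, hlen]
  refine Nat.mul_le_mul_right _ ?_
  nlinarith

theorem treeOutcomeInPolyTime : TreeOutcomeInPolyTime := by
  choose k hk hrun using runsIn_outcome
  refine ⟨{
    tm := sweepMachine
    inputAlphabet := Equiv.refl (Option Bool)
    outputAlphabet := Equiv.refl Outcome
    time := (3 * Polynomial.X + 5) * (4 * Polynomial.X + 4)
    outputsFun := fun T => ⟨⟨k T, ?_⟩, ?_⟩ }⟩
  · have h := hrun T
    rw [← initList_sweepMachine, ← haltList_sweepMachine] at h
    have e : List.map (Equiv.refl (Option Bool)).invFun (encodeTree T) = encodeTree T :=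
      List.map_id _
    refine Eq.trans ?_ h
    exact congrArg (fun l => (flip bind sweepMachine.step)^[k T]
      (some (Turing.initList sweepMachine l))) e
  · refine (hk T).trans (le_of_eq ?_)
    simp

end MBDomination

theorem mainTheorem3 :
    -- `P₃`, rooted at one of its ends, is neutral for the glue operator
    MBDomination.IsGlueNeutral.{u} MBDomination.P3 0 ∧
    -- correctness of the reduction
    (∀ (V : Type u) [Finite V] (T : SimpleGraph V), T.IsTree →
      -- removing pendant `P₂`'s yields trees with the same outcome
      (∀ t : Set V, MBDomination.IsP2Reduct T t →
        (T.induce t).IsTree ∧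
        MBDomination.outcome (T.induce t) = MBDomination.outcome T) ∧
      -- the removals stop, after finitely many steps, at a `P₂`-irreducible tree,
      -- however they are chosen
      (WellFounded fun t s : Set V => MBDomination.RemovesPendantP2 T s t) ∧
      (∃ t : Set V, MBDomination.IsP2Reduct T t ∧ MBDomination.IsP2Irreducible (T.induce t)) ∧
      -- any such tree determines the outcome
      (∀ t : Set V, MBDomination.IsP2Reduct T t → MBDomination.IsP2Irreducible (T.induce t) →
        (Nonempty (T.induce t ≃g MBDomination.P2) →
          MBDomination.outcome T = MBDomination.Outcome.D) ∧
        (MBDomination.IsK1OrStar (T.induce t) →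
          MBDomination.outcome T = MBDomination.Outcome.N) ∧
        (¬ Nonempty (T.induce t ≃g MBDomination.P2) →
          ¬ MBDomination.IsK1OrStar (T.induce t) →
          MBDomination.outcome T = MBDomination.Outcome.S))) ∧
    -- the outcome of a tree can be computed in polynomial time
    MBDomination.TreeOutcomeInPolyTime := by
  refine ⟨MBDomination.isGlueNeutral_P3, fun V _ T hT => ⟨fun t ht => ht.isTree_and_outcome_eq hT,
    MBDomination.wellFounded_removesPendantP2 T,
    MBDomination.exists_isP2Reduct_isP2Irreducible T, fun t ht hirr => ?_⟩,
    MBDomination.treeOutcomeInPolyTime⟩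
  obtain ⟨htree, hout⟩ := ht.isTree_and_outcome_eq hT
  rw [← hout]
  exact ⟨fun ⟨e⟩ => MBDomination.outcome_eq_D_of_iso_P2 e,
    MBDomination.outcome_eq_N_of_isK1OrStar,
    MBDomination.outcome_eq_S_of_not_iso htree hirr⟩
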